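/- **Lemma 7.2.** Let $U$ be a compact Lie group with complexification $U^{\mathbb C}$, i.e. $U^{\mathbb C}$ is a (finite-dimensional, Hausdorff) complex Lie group containing $U$ as a compact subgroup, with Lie algebra $\mathfrak u^{\mathbb C}=\mathfrak u+i\mathfrak u$ and such that $U\times i\mathfrak u\to U^{\mathbb C}$, $(u,\alpha)\mapsto u\exp\alpha$, is a homeomorphism (the Cartan decomposition). Let $Z$ be a finite-dimensional Hausdorff complex manifold with a holomorphic action of $U^{\mathbb C}$ and a smooth $U$-invariant Kähler metric. Fix an $\operatorname{Ad}(U)$-invariant inner product $\langle\cdot,\cdot\rangle$ on $i\mathfrak u\cong\mathfrak u\cong\mathfrak u^*$, and let $\mu\colon Z\to i\mathfrak u$ be a momentum map, i.e. a smooth $U$-equivariant map such that for every $\alpha\in i\mathfrak u$ the function $\mu^\alpha=\langle\mu,\alpha\rangle$ satisfies $\operatorname{grad}\mu^\alpha=\alpha_Z$, where $\alpha_Z$ is the vector field with flow $(t,z)\mapsto\exp(t\alpha)\cdot z$. Let $G\subset U^{\mathbb C}$ be a closed real subgroup that is compatible with the Cartan decomposition: with $\mathfrak g=\{\xi\in\mathfrak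 u^{\mathbb C}:\exp(t\xi)\in G\text{ for all }t\in\mathbb R\}$, $K=U\cap G$ and $\mathfrak p=\mathfrak g\cap i\mathfrak u$, the map $K\times\mathfrak p\to G$, $(k,\alpha)\mapsto k\exp\alpha$, is bijective (equivalently, a homeomorphism). Then: 1. If $X\subset Z$ is a compact $G$-invariant subset, then for every $x\in X$ the closure $\overline{G\cdot x}$ contains a compact $G$-orbit. 2. Every compact $G$-orbit in $Z$ is a $K$-orbit, i.e. if $z\in Z$ and $G\cdot z$ is compact, then $G\cdot z=K\cdot y$ for some $y\in Z$. -/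

import Mathlib

open Set Topology MulAction
open scoped Manifold ContDiff Pointwise

noncomputable section

/-- The real smooth manifold underlying a complex manifold. -/
instance IsManifold.real_of_complex {F M : Type*} [NormedAddCommGroup F] [NormedSpace ℂ F]
    [TopologicalSpace M] [ChartedSpace F M] [h : IsManifold 𝓘(ℂ, F) ω M] :
    IsManifold 𝓘(ℝ, F) ω M := by
  refine isManifold_of_contDiffOn 𝓘(ℝ, F) ω M fun e e' he he' => ?_
  have h1 := (contDiffGroupoid ω 𝓘(ℂ, F)).compatible he he'
  rw [contDiffGroupoid, mem_groupoid_of_pregroupoid] at h1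
  exact h1.1.restrict_scalars ℝ

section LieGroups

/- In this section `H` is a complex Lie group modelled on `E`.  Its Lie algebra, the tangent space
at `1`, is identified with the model space `E` through the preferred chart at `1` (this is the
definition of tangent spaces in Mathlib). -/
variable {E : Type*} [NormedAddCommGroup E] [NormedSpace ℂ E]
  {H : Type*} [TopologicalSpace H] [ChartedSpace E H] [Group H]

/-- `γ` is a (real) one-parameter subgroup of `H` with initial velocity `ξ ∈ T₁H`. -/
structure IsOneParameterSubgroup (γ : ℝ → H) (ξ : E) : Prop where
  map_add : ∀ s t : ℝ, γ (s + t) = γ s * γ t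
  hasMFDerivAt : HasMFDerivAt 𝓘(ℝ, ℝ) 𝓘(ℝ, E) γ 0 (ContinuousLinearMap.toSpanSingleton ℝ ξ)

open Classical in
/-- The exponential map of `H`: the value at time `1` of the one-parameter subgroup with initial
velocity `ξ`.  (That subgroup exists and is unique in every Lie group, so the default value
is never used.) -/
def lieExp (ξ : E) : H :=
  if h : ∃ γ : ℝ → H, IsOneParameterSubgroup γ ξ then h.choose 1 else 1

/-- The adjoint action of `h` on the Lie algebra: the differential at `1` of conjugation by `h`. -/
def lieAd (h : H) : E →L[ℂ] E :=
  mfderiv 𝓘(ℂ, E) 𝓘(ℂ, E) (fun x : H => h * x * h⁻¹) 1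

/-- The (real) Lie algebra of a closed subgroup `S`: all `ξ` with `exp (t ξ) ∈ S` for all real
`t`. -/
def lieAlg (S : Subgroup H) : Set E :=
  {ξ : E | ∀ t : ℝ, (lieExp (t • ξ) : H) ∈ S}

variable (E) in
/-- `H` is the complexification of its compact subgroup `U` (so it is a complex reductive group):
`𝔥 = 𝔲 + i𝔲`, and the Cartan (polar) decomposition `U × i𝔲 → H`, `(u, α) ↦ u exp α`, is a
homeomorphism. -/
structure IsComplexification (U : Subgroup H) : Prop where
  isCompact : IsCompact (U : Set H)
  exists_add : ∀ ξ : E, ∃ a ∈ lieAlg U, ∃ b ∈ Complex.I • lieAlg U, a + b = ξ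
  isHomeomorph : IsHomeomorph
    (fun q : U × (Complex.I • lieAlg U : Set E) => (q.1 : H) * lieExp (q.2 : E))

/-- `𝔭 = 𝔤 ∩ i𝔲`. -/
def cartanP (U G : Subgroup H) : Set E :=
  lieAlg G ∩ Complex.I • lieAlg U

variable (E) in
/-- The closed real subgroup `G` is compatible with the Cartan decomposition `H = U exp(i𝔲)`:
with `K = U ∩ G` and `𝔭 = 𝔤 ∩ i𝔲`, the map `K × 𝔭 → G`, `(k, α) ↦ k exp α`, is bijective.
(Being a restriction of the homeomorphism `U × i𝔲 → H`, it is then a homeomorphism.) -/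
structure IsCompatible (U G : Subgroup H) : Prop where
  isClosed : IsClosed (G : Set H)
  bijOn : BijOn (fun q : H × E => q.1 * lieExp q.2)
    (((U ⊓ G : Subgroup H) : Set H) ×ˢ (cartanP U G : Set E)) (G : Set H)

/-- `B` is an `Ad(U)`-invariant real inner product on `i𝔲`.  Only the values of `B` on `i𝔲`
matter. -/
structure IsInvariantInner (U : Subgroup H) (B : E →ₗ[ℝ] E →ₗ[ℝ] ℝ) : Prop where
  symm : ∀ α ∈ Complex.I • lieAlg U, ∀ α' ∈ Complex.I • lieAlg U, B α α' = B α' α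
  pos : ∀ α ∈ Complex.I • lieAlg U, α ≠ 0 → 0 < B α α
  invariant : ∀ u ∈ U, ∀ α ∈ Complex.I • lieAlg U, ∀ α' ∈ Complex.I • lieAlg U,
    B (lieAd u α) (lieAd u α') = B α α'

end LieGroups

section Kaehler

variable {F : Type*} [NormedAddCommGroup F] [NormedSpace ℂ F]
  {Z : Type*} [TopologicalSpace Z] [ChartedSpace F Z] [IsManifold 𝓘(ℂ, F) ω Z]

/-- A smooth Riemannian metric on the real manifold underlying the complex manifold `Z`. -/
abbrev RealMetric (F Z : Type*) [NormedAddCommGroup F] [NormedSpace ℂ F]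
    [TopologicalSpace Z] [ChartedSpace F Z] [IsManifold 𝓘(ℂ, F) ω Z] : Type _ :=
  Bundle.ContMDiffRiemannianMetric 𝓘(ℝ, F) ∞ F (fun z : Z => TangentSpace 𝓘(ℝ, F) z)

/-- The inner product `(v, w)_z` of the metric `g`; all tangent spaces of `Z` are copies of `F`. -/
def metricAt (g : RealMetric F Z) (z : Z) (v w : F) : ℝ :=
  g.inner z v w

/-- The fundamental form `(v, w) ↦ g(i v, w)` of the metric, written in the chart centred at `z₀`,
i.e. pulled back by the inverse of the chart. -/
def fundamentalFormInChart (g : RealMetric F Z) (z₀ : Z) (x v w : F) : ℝ :=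
  let ψ : F → Z := (extChartAt 𝓘(ℝ, F) z₀).symm
  let dv : F := mfderiv 𝓘(ℝ, F) 𝓘(ℝ, F) ψ x v
  let dw : F := mfderiv 𝓘(ℝ, F) 𝓘(ℝ, F) ψ x w
  metricAt g (ψ x) (Complex.I • dv) dw

/-- The metric is Kähler: multiplication by `i` is isometric on tangent spaces, and the
fundamental form is closed; `dω = 0` is written out in charts on constant vector fields. -/
structure IsKaehler (g : RealMetric F Z) : Prop where
  hermitian : ∀ (z : Z) (v w : F),
    metricAt g z (Complex.I • v) (Complex.I • w) = metricAt g z v w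
  closed : ∀ (z₀ : Z), ∀ x ∈ (extChartAt 𝓘(ℝ, F) z₀).target, ∀ v₀ v₁ v₂ : F,
    fderiv ℝ (fun y => fundamentalFormInChart g z₀ y v₁ v₂) x v₀
      - fderiv ℝ (fun y => fundamentalFormInChart g z₀ y v₀ v₂) x v₁
      + fderiv ℝ (fun y => fundamentalFormInChart g z₀ y v₀ v₁) x v₂ = 0

variable {E : Type*} [NormedAddCommGroup E] [NormedSpace ℂ E]
  {H : Type*} [TopologicalSpace H] [ChartedSpace E H] [Group H] [MulAction H Z]

/-- The metric is invariant under the action of the subgroup `U` of `H`. -/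
def MetricInvariant (U : Subgroup H) (g : RealMetric F Z) : Prop :=
  ∀ u ∈ U, ∀ (z : Z) (v w : F),
    metricAt g (u • z) (mfderiv 𝓘(ℝ, F) 𝓘(ℝ, F) (fun y : Z => u • y) z v)
      (mfderiv 𝓘(ℝ, F) 𝓘(ℝ, F) (fun y : Z => u • y) z w) = metricAt g z v w

variable (H) in
/-- The vector field `ξ_Z` on `Z` of the flow `(t, z) ↦ exp(t ξ) • z`. -/
def fundamentalField (ξ : E) (z : Z) : F :=
  mfderiv 𝓘(ℝ, ℝ) 𝓘(ℝ, F) (fun t : ℝ => (lieExp (t • ξ) : H) • z) 0 (1 : ℝ)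

/-- `μ : Z → i𝔲` is a momentum map, where `𝔲*` is identified with `i𝔲` through the inner product
`B`: it is smooth, `U`-equivariant, and `grad μ^α = α_Z` for `μ^α = B(μ, α)` and all
`α ∈ i𝔲`. -/
structure IsMomentumMap (U : Subgroup H) (B : E →ₗ[ℝ] E →ₗ[ℝ] ℝ) (g : RealMetric F Z)
    (μ : Z → E) : Prop where
  mem : ∀ z, μ z ∈ Complex.I • lieAlg U
  smooth : ContMDiff 𝓘(ℝ, F) 𝓘(ℝ, E) ∞ μ
  equivariant : ∀ u ∈ U, ∀ z, μ (u • z) = lieAd u (μ z)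
  grad : ∀ α ∈ Complex.I • lieAlg U, ∀ (z : Z) (v : F),
    mfderiv 𝓘(ℝ, F) 𝓘(ℝ, ℝ) (fun y : Z => B (μ y) α) z v
      = metricAt g z (fundamentalField H α z) v

end Kaehler

end

noncomputable section

/-! Write `P` for the `B`-orthogonal projection to `𝔭`. On a nonempty compact `G`-invariant set `X`
choose a point `y` where `‖P (μ w)‖²` is maximal, and put `β = P (μ y)`. Expanding `‖P (μ w) - β‖² ≥
0` shows that `y` also maximizes `μ^β` on `X`, and that every other maximizer `w` of `μ^β` in `X`
satisfies `P (μ w) = β`. The claim is that `G y = K y`.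

Since `grad μ^α = α_Z`, the function `μ^α` has derivative `‖α_Z‖²` along the flow of `α`; hence it
is monotone there, and a maximum along the flow is a fixed point. In particular `exp (s β)` fixes
`y`. If `[β, ξ] = c ξ` with `ξ ∈ 𝔤` and `c > 0`, then `exp (s β)` contracts `exp (t ξ) y` to `y` as
`s → -∞`; monotonicity and maximality of `μ^β` at `y` force `exp (t ξ) y = y`
(`IsMomentumMap.orbitDeriv_eq_zero_of_eigenvector`).

The operator `(ad β)²` is symmetric and nonnegative on `𝔭`, so its eigenvectors `v` span `𝔭`. For a
positive eigenvalue `c`, the vector `v + [β, v]/√c` is an eigenvector of `ad β` with eigenvalue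
`√c`, so it acts by zero at `y`; as `[β, v] ∈ 𝔨`, the direction `v` is tangent to `K y`. If `[β, v]
= 0`, then `μ^β` stays maximal along `exp (t v) y`, so `P ∘ μ` and hence `μ^v` is constant there,
and `v` fixes `y`. Thus `𝔭` is tangent to `K y` at `y` (`IsMomentumMap.exists_orbitDeriv_eq`).

By equivariance `𝔭` is tangent to `K y` everywhere. Nagumo's theorem keeps the flows of `𝔭` in this
compact set, and `G = K exp 𝔭` gives `G y = K y` (`IsCompatible.orbit_eq`). Both assertions follow,
with `X` an orbit closure or a compact orbit. -/

theorem ContMDiff.restrictScalars_real {E F M N : Type*} [NormedAddCommGroup E] [NormedSpace ℂ E]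
    [NormedAddCommGroup F] [NormedSpace ℂ F] [TopologicalSpace M] [ChartedSpace E M]
    [TopologicalSpace N] [ChartedSpace F N] {n : ℕ∞ω} {f : M → N}
    (hf : ContMDiff 𝓘(ℂ, E) 𝓘(ℂ, F) n f) : ContMDiff 𝓘(ℝ, E) 𝓘(ℝ, F) n f :=
  fun x => ⟨(hf x).1, ContDiffWithinAt.restrict_scalars ℝ (hf x).2⟩

theorem ContMDiff.restrictScalars_real_prod {E E' F M M' N : Type*}
    [NormedAddCommGroup E] [NormedSpace ℂ E] [NormedAddCommGroup E'] [NormedSpace ℂ E']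
    [NormedAddCommGroup F] [NormedSpace ℂ F] [TopologicalSpace M] [ChartedSpace E M]
    [TopologicalSpace M'] [ChartedSpace E' M']
    [TopologicalSpace N] [ChartedSpace F N] {n : ℕ∞ω} {f : M × M' → N}
    (hf : ContMDiff (𝓘(ℂ, E).prod 𝓘(ℂ, E')) 𝓘(ℂ, F) n f) :
    ContMDiff (𝓘(ℝ, E).prod 𝓘(ℝ, E')) 𝓘(ℝ, F) n f :=
  fun x => ⟨(hf x).1, ContDiffWithinAt.restrict_scalars ℝ (hf x).2⟩

instance LieGroup.real_of_complex {E H : Type*} [NormedAddCommGroup E] [NormedSpace ℂ E]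
    [TopologicalSpace H] [ChartedSpace E H] [Group H] [h : LieGroup 𝓘(ℂ, E) ω H] :
    LieGroup 𝓘(ℝ, E) ω H where
  contMDiff_mul := h.contMDiff_mul.restrictScalars_real_prod
  contMDiff_inv := h.contMDiff_inv.restrictScalars_real

theorem HasMFDerivAt.restrictScalars_real {E F M N : Type*} [NormedAddCommGroup E] [NormedSpace ℂ E]
    [NormedAddCommGroup F] [NormedSpace ℂ F] [TopologicalSpace M] [ChartedSpace E M]
    [TopologicalSpace N] [ChartedSpace F N] {f : M → N} {x : M} {f' : E →L[ℂ] F}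
    (hf : HasMFDerivAt 𝓘(ℂ, E) 𝓘(ℂ, F) f x f') :
    HasMFDerivAt 𝓘(ℝ, E) 𝓘(ℝ, F) f x (f'.restrictScalars ℝ) :=
  ⟨hf.1, HasFDerivWithinAt.restrictScalars ℝ hf.2⟩

/-- Nagumo's invariance theorem: an integral curve of a Lipschitz vector field `v` that starts in a
locally closed set `C` to which `v` is tangent stays in `C`. -/
theorem mem_of_hasDerivAt_of_tangent {F : Type*} [NormedAddCommGroup F] [NormedSpace ℝ F]
    [ProperSpace F] {C : Set F} {v : F → F} {K : NNReal} {x₀ : F} {r ε : ℝ} {γ : ℝ → F}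
    (hv : LipschitzOnWith K v (Metric.closedBall x₀ r))
    (hC : IsClosed (C ∩ Metric.closedBall x₀ r)) (hx₀ : x₀ ∈ C)
    (htan : ∀ x ∈ C ∩ Metric.ball x₀ r, ∃ c : ℝ → F, c 0 = x ∧ HasDerivAt c (v x) 0 ∧
      ∀ᶠ h in 𝓝 (0 : ℝ), c h ∈ C)
    (hγ0 : γ 0 = x₀) (hγr : ∀ t ∈ Icc 0 ε, γ t ∈ Metric.ball x₀ (r / 2))
    (hγ : ∀ t ∈ Icc 0 ε, HasDerivAt γ (v (γ t)) t) :
    ∀ t ∈ Icc 0 ε, γ t ∈ C := by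
  intro t₁ ht₁
  have hr : 0 < r := by
    have := hγr t₁ ht₁
    have := (dist_nonneg).trans_lt (Metric.mem_ball.1 this)
    linarith
  set C' := C ∩ Metric.closedBall x₀ r with hC'
  have hne : C'.Nonempty := ⟨x₀, hx₀, Metric.mem_closedBall_self hr.le⟩
  have hcpt : IsCompact C' := (isCompact_closedBall x₀ r).of_isClosed_subset hC inter_subset_right
  -- Grönwall for the distance to `C'`: its upper right Dini derivative is at most `K` times itself,
  -- and it starts at zero.
  have key : ∀ t ∈ Icc 0 ε, Metric.infDist (γ t) C' ≤ gronwallBound 0 K 0 (t - 0) := by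
    refine le_gronwallBound_of_liminf_deriv_right_le (f' := fun t => K * Metric.infDist (γ t) C')
      ?_ ?_ ?_ ?_
    · exact fun t ht => ((Metric.continuous_infDist_pt C').continuousAt.comp
        (hγ t ht).continuousAt).continuousWithinAt
    · intro t ht ρ hρ
      have ht' : t ∈ Icc 0 ε := Ico_subset_Icc_self ht
      obtain ⟨p, hp, hpd⟩ := hcpt.exists_infDist_eq_dist hne (γ t)
      have hγt := Metric.mem_ball.1 (hγr t ht')
      have hpγ : dist (γ t) p ≤ dist (γ t) x₀ := by
        rw [← hpd]
        exact Metric.infDist_le_dist_of_mem ⟨hx₀, Metric.mem_closedBall_self hr.le⟩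
      -- This is why `γ` is kept within `r / 2`: a nearest point is at most twice as far from `x₀`
      -- as `γ t`, so the tangency hypothesis applies to it.
      have hpb : p ∈ Metric.ball x₀ r := by
        rw [Metric.mem_ball]
        have := dist_triangle_left p x₀ (γ t)
        linarith
      obtain ⟨c, hc0, hcd, hcC⟩ := htan p ⟨hp.1, hpb⟩
      have hcC' : ∀ᶠ h in 𝓝 (0 : ℝ), c h ∈ C' := by
        have : ∀ᶠ h in 𝓝 (0 : ℝ), c h ∈ Metric.ball x₀ r :=
          hcd.continuousAt.eventually_mem (by rw [hc0]; exact Metric.isOpen_ball.mem_nhds hpb)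
        filter_upwards [hcC, this] with h h1 h2 using ⟨h1, Metric.ball_subset_closedBall h2⟩
      -- The curve `c` through the nearest point `p` stays in `C'`, so `‖γ z - c (z - t)‖` bounds
      -- the distance from above, with equality at `z = t`.
      have hq : HasDerivAt (fun z => γ z - c (z - t)) (v (γ t) - v p) t := by
        refine (hγ t ht').sub ?_
        have := HasDerivAt.comp_sub_const (f := c) (f' := v p) t t (by simpa using hcd)
        exact this
      have hlip : ‖v (γ t) - v p‖ ≤ K * Metric.infDist (γ t) C' := by
        rw [hpd, ← dist_eq_norm]
        exact hv.dist_le_mul _ (Metric.mem_closedBall.2 (by linarith)) _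
          (Metric.ball_subset_closedBall hpb)
      have h1 := (hq.hasDerivWithinAt (s := Ioi t)).limsup_slope_norm_le (hlip.trans_lt hρ)
      have h2 : ∀ᶠ z in 𝓝[>] t, c (z - t) ∈ C' := by
        refine Filter.Tendsto.eventually (f := fun z : ℝ => z - t) ?_ hcC'
        have : Filter.Tendsto (fun z : ℝ => z - t) (𝓝 t) (𝓝 (t - t)) :=
          Filter.Tendsto.sub_const Filter.tendsto_id t
        rw [sub_self] at this
        exact this.mono_left nhdsWithin_le_nhds
      refine Filter.Eventually.frequently ?_
      filter_upwards [h1, h2, self_mem_nhdsWithin] with z hz1 hz2 hz3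
      refine lt_of_le_of_lt ?_ hz1
      have hzt : 0 < z - t := sub_pos.2 hz3
      rw [Real.norm_of_nonneg hzt.le]
      refine mul_le_mul_of_nonneg_left ?_ (inv_nonneg.2 hzt.le)
      refine sub_le_sub ?_ ?_
      · rw [← dist_eq_norm]
        exact Metric.infDist_le_dist_of_mem hz2
      · rw [hpd, sub_self, hc0, dist_eq_norm]
    · rw [hγ0]
      exact (Metric.infDist_zero_of_mem (show x₀ ∈ C' from ⟨hx₀, Metric.mem_closedBall_self hr.le⟩)).le
    · intro t _
      simp
  have := key t₁ ht₁
  rw [gronwallBound_ε0_δ0] at this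
  exact ((hC.mem_iff_infDist_zero hne).2 (this.antisymm Metric.infDist_nonneg)).1

/-! ### Velocities of curves in manifolds -/

section Velocity

variable {F M F' M' : Type*} [NormedAddCommGroup F] [NormedSpace ℝ F] [TopologicalSpace M]
  [ChartedSpace F M] [NormedAddCommGroup F'] [NormedSpace ℝ F'] [TopologicalSpace M']
  [ChartedSpace F' M'] {c : ℝ → M} {t : ℝ} {v w : F}

/-- The real differential of `f` at `x`, as a map between the model spaces. -/
def realDeriv (f : M → M') (x : M) : F →L[ℝ] F' :=
  mfderiv 𝓘(ℝ, F) 𝓘(ℝ, F') f x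

theorem HasMFDerivAt.congr_apply_one {f' g' : ℝ →L[ℝ] F}
    (h : HasMFDerivAt 𝓘(ℝ, ℝ) 𝓘(ℝ, F) c t f') (hfg : f' 1 = g' 1) :
    HasMFDerivAt 𝓘(ℝ, ℝ) 𝓘(ℝ, F) c t g' := by
  have : f' = g' := ContinuousLinearMap.ext_ring hfg
  exact this ▸ h

/-- The curve `c` has velocity `v` at time `t`. -/
def HasVelocityAt (c : ℝ → M) (t : ℝ) (v : F) : Prop :=
  HasMFDerivAt 𝓘(ℝ, ℝ) 𝓘(ℝ, F) c t (ContinuousLinearMap.toSpanSingleton ℝ v)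

theorem HasVelocityAt.continuousAt (h : HasVelocityAt c t v) : ContinuousAt c t := h.1

theorem HasVelocityAt.unique (h : HasVelocityAt c t v) (h' : HasVelocityAt c t w) : v = w := by
  have h1 : ContinuousLinearMap.toSpanSingleton ℝ v = ContinuousLinearMap.toSpanSingleton ℝ w :=
    hasMFDerivAt_unique h h'
  simpa using DFunLike.congr_fun h1 1

theorem HasVelocityAt.mfderiv_eq (h : HasVelocityAt c t v) :
    realDeriv (F := ℝ) (F' := F) c t 1 = v := by
  have h1 : realDeriv (F := ℝ) (F' := F) c t =
    ContinuousLinearMap.toSpanSingleton ℝ v := HasMFDerivAt.mfderiv h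
  exact (congrArg (fun L : ℝ →L[ℝ] F => L 1) h1).trans
    (ContinuousLinearMap.toSpanSingleton_apply_one (R₁ := ℝ) v)

theorem HasVelocityAt.comp_hasMFDerivAt (h : HasVelocityAt c t v) {f : M → M'} {f' : F →L[ℝ] F'}
    (hf : HasMFDerivAt 𝓘(ℝ, F) 𝓘(ℝ, F') f (c t) f') :
    HasVelocityAt (fun s => f (c s)) t (f' v) := by
  refine HasMFDerivAt.congr_apply_one (F := F')
    (f' := f'.comp (ContinuousLinearMap.toSpanSingleton ℝ v)) (HasMFDerivAt.comp t hf h) ?_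
  change f' ((1 : ℝ) • v) = (1 : ℝ) • f' v
  simp

theorem HasVelocityAt.comp_mdifferentiableAt (h : HasVelocityAt c t v) {f : M → M'} {x : M}
    (hx : c t = x) (hf : MDifferentiableAt 𝓘(ℝ, F) 𝓘(ℝ, F') f x) :
    HasVelocityAt (fun s => f (c s)) t (realDeriv (F := F) (F' := F') f x v) := by
  subst hx
  exact h.comp_hasMFDerivAt hf.hasMFDerivAt

theorem hasVelocityAt_iff_hasDerivAt {c : ℝ → F} : HasVelocityAt c t v ↔ HasDerivAt c v t := by
  rw [hasDerivAt_iff_hasFDerivAt]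
  exact hasMFDerivAt_iff_hasFDerivAt

theorem HasVelocityAt.comp_hasDerivAt {u : ℝ → ℝ} {a s : ℝ} (h : HasVelocityAt c t v)
    (hu : HasDerivAt u a s) (hs : u s = t) : HasVelocityAt (fun r => c (u r)) s (a • v) := by
  subst hs
  refine (HasVelocityAt.comp_hasMFDerivAt (c := u) (hasVelocityAt_iff_hasDerivAt.2 hu) h)

theorem hasVelocityAt_const (x : M) (t : ℝ) : HasVelocityAt (fun _ => x) t (0 : F) := by
  refine HasMFDerivAt.congr_apply_one (hasMFDerivAt_const (I := 𝓘(ℝ, ℝ)) (I' := 𝓘(ℝ, F)) x t) ?_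
  change (0 : F) = (1 : ℝ) • 0
  simp

theorem isMIntegralCurve_iff_hasVelocityAt {v : M → F} :
    IsMIntegralCurve (I := 𝓘(ℝ, F)) c v ↔ ∀ t, HasVelocityAt c t (v (c t)) := by
  rfl

end Velocity

section Action

variable {E H F Z : Type*} [NormedAddCommGroup E] [NormedSpace ℝ E] [TopologicalSpace H]
  [ChartedSpace E H] [NormedAddCommGroup F] [NormedSpace ℝ F] [TopologicalSpace Z]
  [ChartedSpace F Z]

/-- Leibniz rule for the velocity of a curve `s ↦ f (a s, b s)`. -/
theorem HasVelocityAt.comp₂ {E' H' : Type*} [NormedAddCommGroup E'] [NormedSpace ℝ E']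
    [TopologicalSpace H'] [ChartedSpace E' H'] {f : H × H' → Z} {a : ℝ → H} {b : ℝ → H'} {t : ℝ}
    {v : E} {w : E'} {x : H} {y : H'}
    (hf : MDifferentiableAt (𝓘(ℝ, E).prod 𝓘(ℝ, E')) 𝓘(ℝ, F) f (x, y))
    (ha : HasVelocityAt a t v) (hb : HasVelocityAt b t w) (hx : a t = x) (hy : b t = y) :
    HasVelocityAt (fun s => f (a s, b s)) t
      (realDeriv (F := E) (F' := F) (fun z => f (z, y)) x v
        + realDeriv (F := E') (F' := F) (fun z => f (x, z)) y w) := by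
  subst hx hy
  let f' : E × E' →L[ℝ] F := mfderiv (𝓘(ℝ, E).prod 𝓘(ℝ, E')) 𝓘(ℝ, F) f (a t, b t)
  refine HasMFDerivAt.congr_apply_one (F := F) (f' := f'.comp
    ((ContinuousLinearMap.toSpanSingleton ℝ v).prod (ContinuousLinearMap.toSpanSingleton ℝ w)))
    (HasMFDerivAt.comp t hf.hasMFDerivAt (HasMFDerivAt.prodMk ha hb)) ?_
  have := mfderiv_prod_eq_add_apply (v := ((v, w) : E × E')) hf
  change mfderiv (𝓘(ℝ, E).prod 𝓘(ℝ, E')) 𝓘(ℝ, F) f (a t, b t)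
    (((1 : ℝ) • v, (1 : ℝ) • w) : E × E') = (1 : ℝ) • _
  rw [one_smul, one_smul]
  exact this.trans (one_smul ℝ _).symm

end Action

/-! ### One-parameter subgroups and the exponential map -/

section OneParameter

variable {E : Type*} [NormedAddCommGroup E] [NormedSpace ℂ E]
  {H : Type*} [TopologicalSpace H] [ChartedSpace E H] [Group H]

theorem IsOneParameterSubgroup.map_zero {γ : ℝ → H} {ξ : E} (h : IsOneParameterSubgroup γ ξ) :
    γ 0 = 1 := by
  have := h.map_add 0 0
  simpa using this

variable [LieGroup 𝓘(ℂ, E) ω H]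

theorem mdifferentiable_mul_left_real (h : H) :
    MDifferentiable 𝓘(ℝ, E) 𝓘(ℝ, E) (fun x : H => h * x) :=
  (contMDiff_mul_left (I := 𝓘(ℝ, E)) (n := ω)).mdifferentiable (by simp)

/-- Near time `t` the curve is `γ t * γ (s - t)`, so its velocity is the left translate of `ξ`.
Uniqueness of one-parameter subgroups thereby reduces to uniqueness of integral curves. -/
theorem IsOneParameterSubgroup.isMIntegralCurve {γ : ℝ → H} {ξ : E}
    (h : IsOneParameterSubgroup γ ξ) :
    IsMIntegralCurve (I := 𝓘(ℝ, E)) γ (mulInvariantVectorField (I := 𝓘(ℝ, E)) ξ) := by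
  rw [isMIntegralCurve_iff_hasVelocityAt (v := fun x => mulInvariantVectorField (I := 𝓘(ℝ, E)) ξ x)]
  intro t
  have h0 : HasVelocityAt (fun s => γ (s - t)) t ξ := by
    have := HasVelocityAt.comp_hasDerivAt (c := γ) (t := 0) (v := ξ) (s := t) h.hasMFDerivAt
      ((hasDerivAt_id t).sub_const t) (by simp)
    simpa using this
  have h1 := h0.comp_mdifferentiableAt (x := (1 : H)) (f := fun x => γ t * x) (F' := E)
    (by simp [h.map_zero]) (mdifferentiable_mul_left_real (E := E) _ _)
  have h2 : (fun s => γ t * γ (s - t)) = γ := by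
    ext s
    rw [← h.map_add]; simp
  rw [h2] at h1
  exact h1

theorem contMDiff_mulInvariantVectorField_real (ξ : E) :
    ContMDiff 𝓘(ℝ, E) 𝓘(ℝ, E).tangent 1 (fun g : H =>
      (⟨g, mulInvariantVectorField (I := 𝓘(ℝ, E)) ξ g⟩ : TangentBundle 𝓘(ℝ, E) H)) := by
  have : LieGroup 𝓘(ℝ, E) (minSmoothness ℝ 3) H := LieGroup.of_le (n := ω) le_top
  refine (contMDiff_mulInvariantVectorField (I := 𝓘(ℝ, E)) (G := H) ξ).of_le ?_
  simp

theorem realDeriv_comp {F M F' M' F'' M'' : Type*} [NormedAddCommGroup F] [NormedSpace ℝ F]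
    [TopologicalSpace M] [ChartedSpace F M] [NormedAddCommGroup F'] [NormedSpace ℝ F']
    [TopologicalSpace M'] [ChartedSpace F' M'] [NormedAddCommGroup F''] [NormedSpace ℝ F'']
    [TopologicalSpace M''] [ChartedSpace F'' M''] {f : M → M'} {g : M' → M''} {x : M} {y : M'}
    (hg : MDifferentiableAt 𝓘(ℝ, F') 𝓘(ℝ, F'') g y) (hf : MDifferentiableAt 𝓘(ℝ, F) 𝓘(ℝ, F') f x)
    (hy : f x = y) (v : F) :
    realDeriv (F := F) (F' := F'') (fun z => g (f z)) x v =
      realDeriv (F := F') (F' := F'') g y (realDeriv (F := F) (F' := F') f x v) := by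
  subst hy
  exact mfderiv_comp_apply x hg hf v

/-- The value at `g` of the left-invariant vector field with value `ξ` at `1`. -/
abbrev leftField (ξ : E) (g : H) : E :=
  realDeriv (F := E) (F' := E) (fun x : H => g * x) 1 ξ

theorem HasVelocityAt.mul_left_leftField {γ : ℝ → H} {ξ : E} {t : ℝ} (h : H)
    (hγ : HasVelocityAt γ t (leftField ξ (γ t))) :
    HasVelocityAt (fun s => h * γ s) t (leftField ξ (h * γ t)) := by
  have h1 := hγ.comp_mdifferentiableAt (f := fun x => h * x) (F' := E) rfl
    (mdifferentiable_mul_left_real (E := E) h _)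
  have h2 := realDeriv_comp (F := E) (F' := E) (F'' := E) (f := fun x => γ t * x)
    (g := fun x => h * x) (mdifferentiable_mul_left_real (E := E) h (γ t))
    (mdifferentiable_mul_left_real (E := E) (γ t) 1) (mul_one _) ξ
  simp only [← mul_assoc] at h2
  rw [leftField, h2]
  exact h1

omit [LieGroup 𝓘(ℂ, E) ω H] in
theorem leftField_one (ξ : E) : leftField ξ (1 : H) = ξ := by
  have : (fun x : H => 1 * x) = id := by ext; simp
  rw [leftField, this]
  exact congrArg (fun L : E →L[ℝ] E => L ξ) (mfderiv_id (I := 𝓘(ℝ, E)) (x := (1 : H)))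

variable [T2Space H]

theorem exists_isOneParameterSubgroup [FiniteDimensional ℂ E] (ξ : E) :
    ∃ γ : ℝ → H, IsOneParameterSubgroup γ ξ := by
  have hX := contMDiff_mulInvariantVectorField_real (H := H) ξ
  have : CompleteSpace E := FiniteDimensional.complete ℂ E
  obtain ⟨γ₀, h0, h1⟩ := exists_isMIntegralCurveAt_of_contMDiffAt_boundaryless 0
    (hX.contMDiffAt (x := 1))
  obtain ⟨ε, hε, h2⟩ := isMIntegralCurveAt_iff'.1 h1
  rw [Real.ball_eq_Ioo, zero_sub, zero_add] at h2
  -- Left translates of one local integral curve have the same lifetime `ε` at every point; this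
  -- uniformity makes the field complete.
  have h3 : ∀ x : H, ∃ γ : ℝ → H, γ 0 = x ∧ IsMIntegralCurveOn (I := 𝓘(ℝ, E)) γ
      (mulInvariantVectorField (I := 𝓘(ℝ, E)) ξ) (Ioo (-ε) ε) := by
    refine fun x => ⟨fun t => x * γ₀ t, by simp [h0], fun t ht => ?_⟩
    have h4 := ((h2.isMIntegralCurveAt (isOpen_Ioo.mem_nhds ht)).hasMFDerivAt :)
    exact (HasVelocityAt.mul_left_leftField (E := E) x h4).hasMFDerivWithinAt
  obtain ⟨γ, hγ0, hγ⟩ := exists_isMIntegralCurve_of_isMIntegralCurveOn hX hε h3 1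
  refine ⟨γ, fun s t => ?_, ?_⟩
  · have h5 := hγ.comp_add s
    have h6 : IsMIntegralCurve (I := 𝓘(ℝ, E)) (fun t => γ s * γ t)
        (mulInvariantVectorField (I := 𝓘(ℝ, E)) ξ) :=
      fun t => HasVelocityAt.mul_left_leftField (E := E) (γ s) (hγ t)
    have h7 := isMIntegralCurve_Ioo_eq_of_contMDiff_boundaryless (t₀ := 0) hX h5 h6 (by simp [hγ0])
    simpa [add_comm] using congrFun h7 t
  · have h8 : HasVelocityAt γ 0 (leftField ξ (γ 0)) := hγ 0
    rw [hγ0, leftField_one] at h8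
    exact h8

theorem IsOneParameterSubgroup.unique {γ γ' : ℝ → H} {ξ : E} (h : IsOneParameterSubgroup γ ξ)
    (h' : IsOneParameterSubgroup γ' ξ) : γ = γ' :=
  isMIntegralCurve_Ioo_eq_of_contMDiff_boundaryless (t₀ := 0)
    (contMDiff_mulInvariantVectorField_real ξ) h.isMIntegralCurve h'.isMIntegralCurve
    (by rw [h.map_zero, h'.map_zero])

end OneParameter

section LieExp

variable {E : Type*} [NormedAddCommGroup E] [NormedSpace ℂ E]
  {H : Type*} [TopologicalSpace H] [ChartedSpace E H] [Group H]

theorem IsOneParameterSubgroup.comp_mul {γ : ℝ → H} {ξ : E} (h : IsOneParameterSubgroup γ ξ)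
    (t : ℝ) : IsOneParameterSubgroup (fun s => γ (t * s)) (t • ξ) where
  map_add r s := by rw [mul_add, h.map_add]
  hasMFDerivAt := by
    have h1 : HasVelocityAt γ 0 ξ := h.hasMFDerivAt
    refine h1.comp_hasDerivAt (u := fun s => t * s) ?_ (mul_zero t)
    simpa using (hasDerivAt_id (0 : ℝ)).const_mul t

variable [LieGroup 𝓘(ℂ, E) ω H] [T2Space H]

theorem IsOneParameterSubgroup.lieExp_eq {γ : ℝ → H} {ξ : E} (h : IsOneParameterSubgroup γ ξ) :
    lieExp ξ = γ 1 := by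
  have h1 : ∃ γ : ℝ → H, IsOneParameterSubgroup γ ξ := ⟨γ, h⟩
  rw [lieExp, dif_pos h1, h1.choose_spec.unique h]

theorem IsOneParameterSubgroup.lieExp_smul_eq {γ : ℝ → H} {ξ : E}
    (h : IsOneParameterSubgroup γ ξ) (t : ℝ) : lieExp (t • ξ) = γ t := by
  rw [(h.comp_mul t).lieExp_eq, mul_one]

variable [FiniteDimensional ℂ E]

variable (H) in
theorem isOneParameterSubgroup_lieExp (ξ : E) :
    IsOneParameterSubgroup (fun t : ℝ => (lieExp (t • ξ) : H)) ξ := by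
  obtain ⟨γ, h⟩ := exists_isOneParameterSubgroup (H := H) ξ
  convert h using 2 with t
  exact h.lieExp_smul_eq t

theorem lieExp_zero : (lieExp (0 : E) : H) = 1 := by
  simpa using (isOneParameterSubgroup_lieExp H (0 : E)).map_zero

theorem lieExp_add_smul (s t : ℝ) (ξ : E) :
    (lieExp ((s + t) • ξ) : H) = lieExp (s • ξ) * lieExp (t • ξ) :=
  (isOneParameterSubgroup_lieExp H ξ).map_add s t

theorem lieExp_neg (ξ : E) : (lieExp (-ξ) : H) = (lieExp ξ)⁻¹ := by
  have := lieExp_add_smul (H := H) (-1) 1 ξ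
  rw [eq_inv_iff_mul_eq_one]
  simpa [lieExp_zero] using this.symm

variable (H) in
theorem hasVelocityAt_lieExp_smul (ξ : E) :
    HasVelocityAt (fun t : ℝ => (lieExp (t • ξ) : H)) 0 ξ :=
  (isOneParameterSubgroup_lieExp H ξ).hasMFDerivAt

variable (H) in
theorem continuous_lieExp_smul (ξ : E) : Continuous (fun t : ℝ => (lieExp (t • ξ) : H)) :=
  (isOneParameterSubgroup_lieExp H ξ).isMIntegralCurve.continuous

omit [LieGroup 𝓘(ℂ, E) ω H] [T2Space H] [FiniteDimensional ℂ E] in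
theorem smul_mem_lieAlg {S : Subgroup H} {ξ : E} (h : ξ ∈ lieAlg S) (t : ℝ) :
    t • ξ ∈ lieAlg S := by
  intro s
  rw [smul_smul]
  exact h _

end LieExp

/-! ### Flows of the group action -/

section Action

variable {E : Type*} [NormedAddCommGroup E] [NormedSpace ℂ E]
  {H : Type*} [TopologicalSpace H] [ChartedSpace E H] [Group H]
  {F : Type*} [NormedAddCommGroup F] [NormedSpace ℂ F]
  {Z : Type*} [TopologicalSpace Z] [ChartedSpace F Z] [MulAction H Z]

/-- The differential at `1` of the orbit map `h ↦ h • z`. -/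
def orbitDeriv (E H F : Type*) [NormedAddCommGroup E] [NormedSpace ℂ E]
    [TopologicalSpace H] [ChartedSpace E H] [Group H]
    [NormedAddCommGroup F] [NormedSpace ℂ F]
    {Z : Type*} [TopologicalSpace Z] [ChartedSpace F Z] [MulAction H Z] (z : Z) : E →L[ℝ] F :=
  realDeriv (F := E) (F' := F) (fun h : H => h • z) 1

/-- The action of `H` on `Z` is real-analytic. -/
def IsSmoothAction (E H F Z : Type*) [NormedAddCommGroup E] [NormedSpace ℂ E]
    [TopologicalSpace H] [ChartedSpace E H] [Group H]
    [NormedAddCommGroup F] [NormedSpace ℂ F]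
    [TopologicalSpace Z] [ChartedSpace F Z] [MulAction H Z] : Prop :=
  ContMDiff (𝓘(ℝ, E).prod 𝓘(ℝ, F)) 𝓘(ℝ, F) ω (fun q : H × Z => q.1 • q.2)

variable (hact : IsSmoothAction E H F Z)
include hact

theorem IsSmoothAction.mdifferentiableAt (q : H × Z) :
    MDifferentiableAt (𝓘(ℝ, E).prod 𝓘(ℝ, F)) 𝓘(ℝ, F) (fun q : H × Z => q.1 • q.2) q :=
  ContMDiff.mdifferentiable hact (by simp) q

theorem IsSmoothAction.mdifferentiable_orbit (z : Z) :
    MDifferentiable 𝓘(ℝ, E) 𝓘(ℝ, F) (fun h : H => h • z) := by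
  intro h
  exact MDifferentiableAt.comp (I' := 𝓘(ℝ, E).prod 𝓘(ℝ, F)) (f := fun h : H => (h, z)) h
    (hact.mdifferentiableAt (h, z)) (mdifferentiableAt_id.prodMk mdifferentiableAt_const)

theorem IsSmoothAction.mdifferentiable_smul (h : H) :
    MDifferentiable 𝓘(ℝ, F) 𝓘(ℝ, F) (fun z : Z => h • z) := by
  intro z
  exact MDifferentiableAt.comp (I' := 𝓘(ℝ, E).prod 𝓘(ℝ, F)) (f := fun z : Z => (h, z)) z
    (hact.mdifferentiableAt (h, z)) (mdifferentiableAt_const.prodMk mdifferentiableAt_id)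

theorem IsSmoothAction.hasVelocityAt_smul {c : ℝ → H} {t : ℝ} {ξ : E} (hc : HasVelocityAt c t ξ)
    (h1 : c t = 1) (z : Z) : HasVelocityAt (fun s => c s • z) t (orbitDeriv E H F z ξ) :=
  hc.comp_mdifferentiableAt h1 (hact.mdifferentiable_orbit z 1)

variable [LieGroup 𝓘(ℂ, E) ω H] [T2Space H] [FiniteDimensional ℂ E]

theorem IsSmoothAction.hasVelocityAt_lieExp_zero (ξ : E) (z : Z) :
    HasVelocityAt (fun s : ℝ => (lieExp (s • ξ) : H) • z) 0 (orbitDeriv E H F z ξ) :=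
  hact.hasVelocityAt_smul (hasVelocityAt_lieExp_smul H ξ) (by simp [lieExp_zero]) z

theorem IsSmoothAction.fundamentalField_eq (ξ : E) (z : Z) :
    fundamentalField H ξ z = orbitDeriv E H F z ξ :=
  (hact.hasVelocityAt_lieExp_zero ξ z).mfderiv_eq

theorem IsSmoothAction.hasVelocityAt_lieExp (ξ : E) (z : Z) (t : ℝ) :
    HasVelocityAt (fun s : ℝ => (lieExp (s • ξ) : H) • z) t
      (orbitDeriv E H F ((lieExp (t • ξ) : H) • z) ξ) := by
  have h1 := (hact.hasVelocityAt_lieExp_zero ξ ((lieExp (t • ξ) : H) • z)).comp_hasDerivAt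
    ((hasDerivAt_id t).sub_const t) (by simp)
  simpa only [id, one_smul, smul_smul, ← lieExp_add_smul, sub_add_cancel] using h1

theorem IsSmoothAction.continuous_lieExp_smul (ξ : E) (z : Z) :
    Continuous (fun s : ℝ => (lieExp (s • ξ) : H) • z) :=
  continuous_iff_continuousAt.2 fun t => (hact.hasVelocityAt_lieExp ξ z t).continuousAt

/-- The velocity at time `t` is the image under `exp (t ξ)` of the velocity at time zero, so it
vanishes throughout, and an integral curve of the zero field is constant. -/
theorem IsSmoothAction.lieExp_smul_eq_self [IsManifold 𝓘(ℂ, F) ω Z] [T2Space Z] {ξ : E} {z : Z}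
    (h : orbitDeriv E H F z ξ = 0) (t : ℝ) : (lieExp (t • ξ) : H) • z = z := by
  have h0 : IsMIntegralCurve (I := 𝓘(ℝ, F)) (fun s : ℝ => (lieExp (s • ξ) : H) • z)
      (0 : (x : Z) → TangentSpace 𝓘(ℝ, F) x) := by
    intro t
    have h1 := ((hact.hasVelocityAt_lieExp_zero ξ z).comp_hasDerivAt
      ((hasDerivAt_id t).sub_const t) (by simp)).comp_mdifferentiableAt rfl
      (hact.mdifferentiable_smul (lieExp (t • ξ) : H) _)
    rw [h, smul_zero, map_zero] at h1
    simp only [id, smul_smul, ← lieExp_add_smul, add_sub_cancel] at h1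
    exact h1
  have h2 := isMIntegralCurve_Ioo_eq_of_contMDiff_boundaryless (t₀ := 0)
    (Bundle.contMDiff_zeroSection ℝ (TangentSpace 𝓘(ℝ, F) : Z → Type _)) h0
    (isMIntegralCurve_const (x := z) rfl) (by simp [lieExp_zero])
  exact congrFun h2 t

end Action

theorem HasVelocityAt.chart {F M : Type*} [NormedAddCommGroup F] [NormedSpace ℂ F]
    [TopologicalSpace M] [ChartedSpace F M]
    [IsManifold 𝓘(ℂ, F) ω M] {c : ℝ → M} {t : ℝ} {v : F} (h : HasVelocityAt c t v) {y : M}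
    (hy : c t ∈ (chartAt F y).source) :
    HasDerivAt (fun s => chartAt F y (c s)) (realDeriv (F := F) (F' := F) (chartAt F y) (c t) v) t :=
  hasVelocityAt_iff_hasDerivAt.1 (h.comp_mdifferentiableAt rfl
    (mdifferentiableAt_atlas (I := 𝓘(ℝ, F)) (chart_mem_atlas F y) hy))

/-! ### Closed sets invariant under a flow -/

section Invariance

variable {E : Type*} [NormedAddCommGroup E] [NormedSpace ℂ E]
  {H : Type*} [TopologicalSpace H] [ChartedSpace E H] [Group H]
  {F : Type*} [NormedAddCommGroup F] [NormedSpace ℂ F]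
  {Z : Type*} [TopologicalSpace Z] [ChartedSpace F Z] [MulAction H Z]
  (hact : IsSmoothAction E H F Z)

include hact

/-- The action, written in the charts at `1` and `y`, is smooth. -/
theorem IsSmoothAction.contDiffAt_chart (y : Z) :
    ContDiffAt ℝ ω (fun q : E × F =>
      chartAt F y ((chartAt E (1 : H)).symm q.1 • (chartAt F y).symm q.2))
      (chartAt E (1 : H) 1, chartAt F y y) := by
  have h := (hact (1, y)).2
  rw [show ((1 : H), y).1 • ((1 : H), y).2 = y from one_smul _ _] at h
  exact (h.contDiffAt (by simp) :)

variable [LieGroup 𝓘(ℂ, E) ω H] [T2Space H] [FiniteDimensional ℂ E]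
  [IsManifold 𝓘(ℂ, F) ω Z] [FiniteDimensional ℂ F]

/-- Nagumo's theorem for the field of `ξ`, transported to a chart at `y`; the result is local in
time because the flow may leave the chart. -/
theorem IsSmoothAction.exists_forall_lieExp_smul_mem {C : Set Z} (hC : IsClosed C) {ξ : E}
    (htan : ∀ w ∈ C, ∃ c : ℝ → Z, c 0 = w ∧ HasVelocityAt c 0 (orbitDeriv E H F w ξ) ∧
      ∀ s, c s ∈ C) {y : Z} (hy : y ∈ C) :
    ∃ ε > 0, ∀ t ∈ Icc (0 : ℝ) ε, (lieExp (t • ξ) : H) • y ∈ C := by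
  set φ := chartAt F y with hφ
  set ψ := chartAt E (1 : H) with hψ
  set Ψ : E × F → F := fun q => φ (ψ.symm q.1 • φ.symm q.2) with hΨ
  have hΨs : ContDiffAt ℝ ω Ψ (ψ 1, φ y) := hact.contDiffAt_chart y
  -- The field of `ξ` in the chart, written as a partial derivative of the smooth action so that it
  -- is `C¹`, hence Lipschitz near `φ y`.
  set v : F → F := fun x => fderiv ℝ Ψ (ψ 1, x) (ξ, 0) with hv
  have hyφ : y ∈ φ.source := mem_chart_source F y
  have hpair : Continuous (fun x : F => (ψ 1, x)) := by fun_prop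
  have hvs : ContDiffAt ℝ 1 v (φ y) := by
    have h1 : ContDiffAt ℝ 1 (fderiv ℝ Ψ) (ψ 1, φ y) := hΨs.fderiv_right (m := 1) le_top
    have h2 : ContDiffAt ℝ 1 (fun x : F => fderiv ℝ Ψ (ψ 1, x)) (φ y) :=
      h1.comp (φ y) (f := fun x : F => (ψ 1, x)) (by fun_prop)
    exact h2.clm_apply contDiffAt_const
  obtain ⟨K, V, hV, hK⟩ := hvs.exists_lipschitzOnWith
  have hdiff : ∀ᶠ x in 𝓝 (φ y), DifferentiableAt ℝ Ψ (ψ 1, x) := by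
    have h1 : ∀ᶠ q in 𝓝 (ψ 1, φ y), ContDiffAt ℝ 1 Ψ q :=
      (hΨs.of_le (m := 1) le_top).eventually (by simp)
    exact (hpair.continuousAt.eventually h1).mono fun x hx => hx.differentiableAt (by simp)
  have hgood : ∀ᶠ x in 𝓝 (φ y), x ∈ V ∧ x ∈ φ.target ∧ DifferentiableAt ℝ Ψ (ψ 1, x) :=
    Filter.Eventually.and hV
      (Filter.Eventually.and (φ.open_target.mem_nhds (φ.map_source hyφ)) hdiff)
  obtain ⟨r, hr, hball⟩ := Metric.nhds_basis_closedBall.eventually_iff.1 hgood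
  -- the vector field in the chart
  have hfield : ∀ x ∈ Metric.closedBall (φ y) r,
      realDeriv (F := F) (F' := F) φ (φ.symm x) (orbitDeriv E H F (φ.symm x) ξ) = v x := by
    intro x hx
    obtain ⟨-, hxt, hxd⟩ := hball hx
    have hxs := φ.map_target hxt
    have h0 := hact.hasVelocityAt_lieExp_zero ξ (φ.symm x)
    have h1 := h0.chart (y := y) (by simpa [lieExp_zero] using hxs)
    simp only [zero_smul, lieExp_zero, one_smul] at h1
    have h2 : HasDerivAt (fun s : ℝ => (ψ (lieExp (s • ξ)), x)) ((ξ, 0) : E × F) 0 := by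
      refine HasDerivAt.prodMk ?_ (hasDerivAt_const _ _)
      have h3 := (hasVelocityAt_lieExp_smul H ξ).2
      simp only [writtenInExtChartAt] at h3
      rw [zero_smul, lieExp_zero] at h3
      have h4 := HasFDerivWithinAt.hasFDerivAt (𝕜 := ℝ) h3 (by simp)
      exact hasDerivAt_iff_hasFDerivAt.2 h4
    have h5 : HasDerivAt (fun s : ℝ => Ψ (ψ (lieExp (s • ξ)), x)) (v x) 0 := by
      refine HasFDerivAt.comp_hasDerivAt (x := (0 : ℝ)) (l := Ψ) ?_ h2
      simpa [lieExp_zero] using hxd.hasFDerivAt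
    refine h1.unique (h5.congr_of_eventuallyEq ?_)
    have h6 : ∀ᶠ s : ℝ in 𝓝 0, (lieExp (s • ξ) : H) ∈ ψ.source := by
      refine (_root_.continuous_lieExp_smul H ξ).continuousAt.eventually_mem ?_
      simpa [lieExp_zero] using ψ.open_source.mem_nhds (mem_chart_source E (1 : H))
    filter_upwards [h6] with s hs
    simp only [hΨ, ψ.left_inv hs]
    rfl
  have hcont : Continuous fun s : ℝ => (lieExp (s • ξ) : H) • y := hact.continuous_lieExp_smul ξ y
  have hγ : ∀ᶠ s : ℝ in 𝓝 0, (lieExp (s • ξ) : H) • y ∈ φ.source ∧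
      φ ((lieExp (s • ξ) : H) • y) ∈ Metric.ball (φ y) (r / 2) := by
    have h0 : (lieExp ((0 : ℝ) • ξ) : H) • y = y := by simp [lieExp_zero]
    have h1 : φ.source ∩ φ ⁻¹' Metric.ball (φ y) (r / 2) ∈ 𝓝 y :=
      (φ.continuousOn.isOpen_inter_preimage φ.open_source Metric.isOpen_ball).mem_nhds
        ⟨hyφ, Metric.mem_ball_self (by positivity)⟩
    exact hcont.continuousAt.eventually_mem (by rwa [h0])
  obtain ⟨δ, hδ, hδ'⟩ := Metric.nhds_basis_closedBall.eventually_iff.1 hγ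
  have hIcc : ∀ s ∈ Icc (0 : ℝ) δ, s ∈ Metric.closedBall (0 : ℝ) δ := by
    intro s hs
    rw [mem_closedBall_zero_iff, Real.norm_of_nonneg hs.1]
    exact hs.2
  have : ProperSpace F := FiniteDimensional.proper ℂ F
  have hsub : Metric.closedBall (φ y) r ⊆ φ.target := fun x hx => (hball hx).2.1
  have hmain := mem_of_hasDerivAt_of_tangent (C := φ.target ∩ φ.symm ⁻¹' C) (v := v) (K := K)
    (x₀ := φ y) (r := r) (ε := δ) (γ := fun s => φ ((lieExp (s • ξ) : H) • y))
    (hK.mono fun x hx => (hball hx).1) ?_ ⟨φ.map_source hyφ, by simpa [φ.left_inv hyφ] using hy⟩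
    ?_ (by simp [lieExp_zero]) (fun s hs => (hδ' (hIcc s hs)).2) ?_
  · refine ⟨δ, hδ, fun t ht => ?_⟩
    have h1 := (hmain t ht).2
    rwa [mem_preimage, φ.left_inv (hδ' (hIcc t ht)).1] at h1
  · have h1 : IsClosed (Metric.closedBall (φ y) r ∩ φ.symm ⁻¹' C) :=
      (φ.continuousOn_symm.mono hsub).preimage_isClosed_of_isClosed Metric.isClosed_closedBall hC
    convert h1 using 1
    ext x
    constructor
    · exact fun hx => ⟨hx.2, hx.1.2⟩
    · exact fun hx => ⟨⟨hsub hx.1, hx.2⟩, hx.1⟩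
  · rintro x ⟨⟨hxt, hxC⟩, hxr⟩
    obtain ⟨c, hc0, hc, hcC⟩ := htan _ hxC
    have hsrc : c 0 ∈ φ.source := hc0 ▸ φ.map_target hxt
    refine ⟨fun s => φ (c s), by simp [hc0, φ.right_inv hxt], ?_, ?_⟩
    · rw [← hfield x (Metric.ball_subset_closedBall hxr), ← hc0]
      rw [← hc0] at hc
      exact hc.chart hsrc
    · filter_upwards [hc.continuousAt.eventually_mem (φ.open_source.mem_nhds hsrc)] with s hs
      exact ⟨φ.map_source hs, by simpa [φ.left_inv hs] using hcC s⟩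
  · intro t ht
    obtain ⟨h1, h2⟩ := hδ' (hIcc t ht)
    have h4 : φ ((lieExp (t • ξ) : H) • y) ∈ Metric.closedBall (φ y) r :=
      Metric.closedBall_subset_closedBall (by linarith) (Metric.ball_subset_closedBall h2)
    have h5 := hfield _ h4
    rw [φ.left_inv h1] at h5
    rw [← h5]
    exact (hact.hasVelocityAt_lieExp ξ y t).chart h1

/-- The set of good times is closed, and the local result, restarted at any good time, extends it to
the right. -/
theorem IsSmoothAction.lieExp_smul_mem_of_tangent {C : Set Z} (hC : IsClosed C) {ξ : E}
    (htan : ∀ w ∈ C, ∃ c : ℝ → Z, c 0 = w ∧ HasVelocityAt c 0 (orbitDeriv E H F w ξ) ∧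
      ∀ s, c s ∈ C) {y : Z} (hy : y ∈ C) {t : ℝ} (ht : 0 ≤ t) :
    (lieExp (t • ξ) : H) • y ∈ C := by
  have hcl : IsClosed {s : ℝ | (lieExp (s • ξ) : H) • y ∈ C} :=
    hC.preimage (hact.continuous_lieExp_smul ξ y)
  refine IsClosed.Icc_subset_of_forall_exists_gt (a := (0 : ℝ)) (b := t) (hcl.inter isClosed_Icc)
    (by simpa [lieExp_zero] using hy) ?_ (right_mem_Icc.2 ht)
  rintro s ⟨hs, -⟩ u hu
  obtain ⟨ε, hε, h⟩ := hact.exists_forall_lieExp_smul_mem hC htan hs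
  have hu' : s < u := hu
  have h0 : 0 < min ε (u - s) := lt_min hε (sub_pos.2 hu')
  refine ⟨s + min ε (u - s), ?_, by linarith, by linarith [min_le_right ε (u - s)]⟩
  have := h _ ⟨h0.le, min_le_left _ _⟩
  rwa [smul_smul, ← lieExp_add_smul, add_comm] at this

end Invariance

/-! ### Lie algebras of closed subgroups and the adjoint representation -/

section LieAlgebra

variable {E : Type*} [NormedAddCommGroup E] [NormedSpace ℂ E]
  {H : Type*} [TopologicalSpace H] [ChartedSpace E H] [Group H]

theorem realDeriv_id {F M : Type*} [NormedAddCommGroup F] [NormedSpace ℝ F] [TopologicalSpace M]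
    [ChartedSpace F M] (x : M) (v : F) : realDeriv (F := F) (F' := F) (fun z : M => z) x v = v :=
  congrArg (fun L : F →L[ℝ] F => L v) (mfderiv_id (I := 𝓘(ℝ, F)) (x := x))

variable [LieGroup 𝓘(ℂ, E) ω H]

variable (E H) in
theorem isSmoothAction_mul : IsSmoothAction E H E H :=
  contMDiff_mul 𝓘(ℝ, E) ω

theorem IsSmoothAction.hasVelocityAt_lieExp_add [T2Space H] [FiniteDimensional ℂ E]
    {F Z : Type*} [NormedAddCommGroup F] [NormedSpace ℂ F]
    [TopologicalSpace Z] [ChartedSpace F Z] [MulAction H Z] (hact : IsSmoothAction E H F Z)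
    (a b : E) (z : Z) :
    HasVelocityAt (fun s : ℝ => (lieExp (s • a) : H) • (lieExp (s • b) : H) • z) 0
      (orbitDeriv E H F z (a + b)) := by
  have h := HasVelocityAt.comp₂ (F := F) (f := fun q : H × Z => q.1 • q.2) (x := (1 : H)) (y := z)
    (hact.mdifferentiableAt _) (hasVelocityAt_lieExp_smul H a)
    (hact.hasVelocityAt_lieExp_zero b z) (by simp [lieExp_zero]) (by simp [lieExp_zero])
  simp only [one_smul, realDeriv_id] at h
  rw [map_add]
  exact h

variable [T2Space H] [FiniteDimensional ℂ E]

/-- Flow invariance replaces the Trotter product formula: for left multiplication of `H` on itself,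
`s ↦ exp (s a) exp (s b) w` is a curve in `S` with the velocity of the field of `a + b` at `w`. -/
theorem add_mem_lieAlg {S : Subgroup H} (hS : IsClosed (S : Set H)) {a b : E}
    (ha : a ∈ lieAlg S) (hb : b ∈ lieAlg S) : a + b ∈ lieAlg S := by
  have key : ∀ t : ℝ, 0 ≤ t → (lieExp (t • (a + b)) : H) ∈ S := by
    intro t ht
    have := (isSmoothAction_mul E H).lieExp_smul_mem_of_tangent (C := (S : Set H)) hS
      (ξ := a + b) (fun w hw => ⟨_, ?_, (isSmoothAction_mul E H).hasVelocityAt_lieExp_add a b w,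
        fun s => S.mul_mem (ha s) (S.mul_mem (hb s) hw)⟩) S.one_mem ht
    · simpa using this
    · simp [lieExp_zero]
  intro t
  rcases le_total 0 t with ht | ht
  · exact key t ht
  · have := S.inv_mem (key (-t) (by linarith))
    rwa [← lieExp_neg, neg_smul, neg_neg] at this

/-- The Lie algebra of a closed subgroup is a real subspace. -/
def lieAlgSubmodule (S : Subgroup H) (hS : IsClosed (S : Set H)) : Submodule ℝ E where
  carrier := lieAlg S
  add_mem' := add_mem_lieAlg hS
  zero_mem' := fun t => by rw [smul_zero, lieExp_zero]; exact S.one_mem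
  smul_mem' t _ h := smul_mem_lieAlg h t

theorem eq_of_lieExp_smul_eq {ξ η : E} (h : ∀ t : ℝ, (lieExp (t • ξ) : H) = lieExp (t • η)) :
    ξ = η := by
  have h1 := hasVelocityAt_lieExp_smul H ξ
  simp only [h] at h1
  exact h1.unique (hasVelocityAt_lieExp_smul H η)

omit [T2Space H] [FiniteDimensional ℂ E] in
theorem contMDiff_conj (h : H) : ContMDiff 𝓘(ℂ, E) 𝓘(ℂ, E) ω (fun x : H => h * x * h⁻¹) :=
  (contMDiff_mul_right (a := h⁻¹)).comp (contMDiff_mul_left (a := h))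

omit [T2Space H] [FiniteDimensional ℂ E] in
theorem HasVelocityAt.conj {c : ℝ → H} {t : ℝ} {ξ : E} (hc : HasVelocityAt c t ξ) (h1 : c t = 1)
    (h : H) : HasVelocityAt (fun s => h * c s * h⁻¹) t (lieAd h ξ) := by
  have h2 : MDifferentiableAt 𝓘(ℂ, E) 𝓘(ℂ, E) (fun x : H => h * x * h⁻¹) 1 :=
    (contMDiff_conj h).mdifferentiable (by simp) 1
  have h3 := HasMFDerivAt.restrictScalars_real (f' := lieAd h) h2.hasMFDerivAt
  rw [← h1] at h3
  exact hc.comp_hasMFDerivAt h3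

theorem lieExp_smul_lieAd (h : H) (ξ : E) (t : ℝ) :
    (lieExp (t • lieAd h ξ) : H) = h * lieExp (t • ξ) * h⁻¹ := by
  have h1 : IsOneParameterSubgroup (fun t : ℝ => h * lieExp (t • ξ) * h⁻¹) (lieAd h ξ) :=
    ⟨fun s t => by simp only [lieExp_add_smul]; group,
      (hasVelocityAt_lieExp_smul H ξ).conj (by simp [lieExp_zero]) h⟩
  exact h1.lieExp_smul_eq t

theorem lieAd_mul (h k : H) (ξ : E) : lieAd (h * k) ξ = lieAd h (lieAd k ξ) := by
  refine eq_of_lieExp_smul_eq (H := H) fun t => ?_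
  simp only [lieExp_smul_lieAd]
  group

theorem lieAd_one (ξ : E) : lieAd (1 : H) ξ = ξ := by
  refine eq_of_lieExp_smul_eq (H := H) fun t => ?_
  simp [lieExp_smul_lieAd]

theorem lieAd_mem_lieAlg {S : Subgroup H} {h : H} (hh : h ∈ S) {ξ : E} (hξ : ξ ∈ lieAlg S) :
    lieAd h ξ ∈ lieAlg S := by
  intro t
  rw [lieExp_smul_lieAd]
  exact S.mul_mem (S.mul_mem hh (hξ t)) (S.inv_mem hh)

variable (E H) in
omit [T2Space H] [FiniteDimensional ℂ E] in
theorem contDiffAt_conj_chart :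
    ContDiffAt ℂ ω (fun q : E × E => chartAt E (1 : H) ((chartAt E (1 : H)).symm q.1 *
      (chartAt E (1 : H)).symm q.2 * ((chartAt E (1 : H)).symm q.1)⁻¹))
      (chartAt E (1 : H) 1, chartAt E (1 : H) 1) := by
  have h0 : ContMDiff (𝓘(ℂ, E).prod 𝓘(ℂ, E)) 𝓘(ℂ, E) ω
      (fun q : H × H => q.1 * q.2 * q.1⁻¹) :=
    (contMDiff_fst.mul contMDiff_snd).mul contMDiff_fst.inv
  have h := (h0 (1, 1)).2
  rw [show ((1 : H), (1 : H)).1 * ((1 : H), (1 : H)).2 * ((1 : H), (1 : H)).1⁻¹ = 1 by simp] at h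
  exact (h.contDiffAt (by simp) :)

variable (E H) in
/-- The adjoint representation is differentiable at `1`, with complex linear differential `ad`. -/
theorem exists_hasDerivAt_lieAd :
    ∃ ad : E →L[ℂ] E →L[ℂ] E, ∀ ξ η : E,
      HasDerivAt (fun s : ℝ => lieAd (lieExp (s • ξ) : H) η) (ad ξ η) 0 := by
  set φ := chartAt E (1 : H) with hφ
  set Θ : E × E → E := fun q => φ (φ.symm q.1 * φ.symm q.2 * (φ.symm q.1)⁻¹) with hΘ
  have hΘs : ContDiffAt ℂ ω Θ (φ 1, φ 1) := contDiffAt_conj_chart E H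
  have h1φ : (1 : H) ∈ φ.source := mem_chart_source E 1
  -- Near `1`, `L (φ h)` is `Ad h`: the derivative of conjugation in its second variable. Holomorphy
  -- of `Θ` makes the derivative of `L` complex linear.
  set L : E → E →L[ℂ] E := fun x =>
    (fderiv ℂ Θ (x, φ 1)).comp (ContinuousLinearMap.inr ℂ E E) with hL
  have hLd : DifferentiableAt ℂ L (φ 1) := by
    have h1 : ContDiffAt ℂ 1 (fderiv ℂ Θ) (φ 1, φ 1) := hΘs.fderiv_right (m := 1) le_top
    have h2 : ContDiffAt ℂ 1 (fun x : E => fderiv ℂ Θ (x, φ 1)) (φ 1) :=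
      h1.comp (φ 1) (f := fun x : E => (x, φ 1)) (by fun_prop)
    exact (h2.clm_comp contDiffAt_const).differentiableAt (by simp)
  have hexp : ∀ η : E, HasDerivAt (fun s : ℝ => φ (lieExp (s • η))) η 0 := by
    intro η
    have h := (hasVelocityAt_lieExp_smul H η).2
    simp only [writtenInExtChartAt] at h
    rw [zero_smul, lieExp_zero] at h
    exact hasDerivAt_iff_hasFDerivAt.2 (HasFDerivWithinAt.hasFDerivAt (𝕜 := ℝ) h (by simp))
  have hsrc : ∀ η : E, ∀ᶠ s : ℝ in 𝓝 0, (lieExp (s • η) : H) ∈ φ.source := by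
    intro η
    refine (continuous_lieExp_smul H η).continuousAt.eventually_mem ?_
    simpa [lieExp_zero] using φ.open_source.mem_nhds h1φ
  have hAd : ∀ᶠ h in 𝓝 (1 : H), ∀ η : E, lieAd h η = L (φ h) η := by
    have h1 : ∀ᶠ q in 𝓝 (φ 1, φ 1), ContDiffAt ℂ 1 Θ q :=
      (hΘs.of_le (m := 1) le_top).eventually (by simp)
    have h2 : ContinuousAt (fun h : H => (φ h, φ 1)) 1 :=
      (φ.continuousAt h1φ).prodMk continuousAt_const
    filter_upwards [h2.eventually h1, φ.open_source.mem_nhds h1φ] with h hh hhs η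
    have h3 := ((hasVelocityAt_lieExp_smul H η).conj (by simp [lieExp_zero]) h).2
    simp only [writtenInExtChartAt] at h3
    rw [show h * lieExp ((0 : ℝ) • η) * h⁻¹ = 1 by simp [lieExp_zero]] at h3
    have h4 : HasDerivAt (fun s : ℝ => φ (h * lieExp (s • η) * h⁻¹)) (lieAd h η) 0 :=
      hasDerivAt_iff_hasFDerivAt.2 (HasFDerivWithinAt.hasFDerivAt (𝕜 := ℝ) h3 (by simp))
    have h5 : HasDerivAt (fun s : ℝ => Θ (φ h, φ (lieExp (s • η)))) (L (φ h) η) 0 := by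
      have h6 := ((hh.differentiableAt (by simp)).hasFDerivAt.restrictScalars ℝ)
      refine HasFDerivAt.comp_hasDerivAt (x := (0 : ℝ)) (l := Θ)
        (l' := (fderiv ℂ Θ (φ h, φ 1)).restrictScalars ℝ)
        (f := fun s : ℝ => (φ h, φ (lieExp (s • η)))) (f' := (0, η)) ?_
        ((hasDerivAt_const _ _).prodMk (hexp η))
      simpa [lieExp_zero] using h6
    refine h4.unique (h5.congr_of_eventuallyEq ?_)
    filter_upwards [hsrc η] with s hs
    simp only [hΘ, φ.left_inv hs, φ.left_inv hhs]
  refine ⟨fderiv ℂ L (φ 1), fun ξ η => ?_⟩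
  have h1 : HasDerivAt (fun s : ℝ => L (φ (lieExp (s • ξ)))) (fderiv ℂ L (φ 1) ξ) 0 := by
    refine HasFDerivAt.comp_hasDerivAt (x := (0 : ℝ)) (l := L)
      (l' := (fderiv ℂ L (φ 1)).restrictScalars ℝ) ?_ (hexp ξ)
    simpa [lieExp_zero] using hLd.hasFDerivAt.restrictScalars ℝ
  have h2 : HasDerivAt (fun s : ℝ => L (φ (lieExp (s • ξ))) η) (fderiv ℂ L (φ 1) ξ η) 0 :=
    HasFDerivAt.comp_hasDerivAt (x := (0 : ℝ)) (l := fun A : E →L[ℂ] E => A η)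
      (((ContinuousLinearMap.apply ℂ E η).restrictScalars ℝ).hasFDerivAt) h1
  refine h2.congr_of_eventuallyEq ?_
  have h3 : Filter.Tendsto (fun s : ℝ => (lieExp (s • ξ) : H)) (𝓝 0) (𝓝 1) := by
    simpa [lieExp_zero] using (continuous_lieExp_smul H ξ).tendsto 0
  exact (h3.eventually hAd).mono fun s hs => hs η

end LieAlgebra

/-! ### Linear algebra of a positive form -/

section BilinearForm

variable {V : Type*} [AddCommGroup V] [Module ℝ V] [FiniteDimensional ℝ V]
  {b : V →ₗ[ℝ] V →ₗ[ℝ] ℝ}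

/-- A subspace containing all eigenvectors of a symmetric operator is the whole space. -/
theorem eq_top_of_forall_eigenvector_mem (hsymm : ∀ v w, b v w = b w v)
    (hpos : ∀ v, v ≠ 0 → 0 < b v v) (S : V →ₗ[ℝ] V) (hS : ∀ v w, b (S v) w = b v (S w))
    (W : Submodule ℝ V) (hW : ∀ (c : ℝ) (v : V), S v = c • v → v ∈ W) : W = ⊤ := by
  have hnonneg : ∀ v, 0 ≤ b v v := fun v => by
    by_cases hv : v = 0
    · simp [hv]
    · exact (hpos v hv).le
  let core : InnerProductSpace.Core ℝ V :=
    { inner := fun v w => b v w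
      conj_inner_symm := fun v w => by simpa using hsymm w v
      re_inner_nonneg := fun v => by simpa using hnonneg v
      add_left := fun u v w => by simp
      smul_left := fun u v c => by simp
      definite := fun v hv => by
        by_contra h
        exact (hpos v h).ne' hv }
  let : NormedAddCommGroup V := core.toNormedAddCommGroup
  let : InnerProductSpace ℝ V := InnerProductSpace.ofCore core.toCore
  have hsym : S.IsSymmetric := fun v w => hS v w
  have h1 := hsym.orthogonalComplement_iSup_eigenspaces_eq_bot
  rw [Submodule.orthogonal_eq_bot_iff] at h1
  rw [eq_top_iff, ← h1]
  exact iSup_le fun c v hv => hW c v (Module.End.mem_eigenspace_iff.1 hv)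

/-- Positivity makes `V → V*` injective, and equal dimensions make it bijective. It supplies the
projection to `𝔭`, although `B` need not be definite or symmetric on all of `E`. -/
theorem exists_riesz (hpos : ∀ v, v ≠ 0 → 0 < b v v) {E : Type*} [AddCommGroup E] [Module ℝ E]
    (ℓ : E →ₗ[ℝ] V →ₗ[ℝ] ℝ) : ∃ P : E →ₗ[ℝ] V, ∀ m v, b (P m) v = ℓ m v := by
  have hinj : Function.Injective b := by
    rw [← LinearMap.ker_eq_bot, LinearMap.ker_eq_bot']
    intro v hv
    by_contra h
    exact (hpos v h).ne' (by rw [hv]; rfl)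
  let e : V ≃ₗ[ℝ] (V →ₗ[ℝ] ℝ) := LinearEquiv.ofInjectiveOfFinrankEq b hinj
    (Subspace.dual_finrank_eq (K := ℝ) (V := V)).symm
  refine ⟨e.symm.toLinearMap ∘ₗ ℓ, fun m v => ?_⟩
  have : b (e.symm (ℓ m)) = ℓ m := e.apply_symm_apply (ℓ m)
  exact congrArg (fun L : V →ₗ[ℝ] ℝ => L v) this

end BilinearForm

/-! ### The bracket, its eigenvectors and its skewness on `i𝔲` -/

section Adjoint

theorem HasDerivAt.mem_of_isClosed_submodule {E : Type*} [NormedAddCommGroup E] [NormedSpace ℝ E]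
    {W : Submodule ℝ E} (hW : IsClosed (W : Set E)) {c : ℝ → E} {v : E} {t : ℝ}
    (hc : HasDerivAt c v t) (hmem : ∀ s, c s ∈ W) : v ∈ W := by
  refine hW.mem_of_tendsto (hasDerivAt_iff_tendsto_slope.1 hc) (.of_forall fun s => ?_)
  exact W.smul_mem _ (W.sub_mem (hmem s) (hmem t))

variable {E : Type*} [NormedAddCommGroup E] [NormedSpace ℂ E] [FiniteDimensional ℂ E]
  {H : Type*} [TopologicalSpace H] [T2Space H] [ChartedSpace E H] [Group H]
  [LieGroup 𝓘(ℂ, E) ω H]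

variable (E H) in
/-- The differential at `1` of the adjoint representation. -/
def lieAdDeriv : E →L[ℂ] E →L[ℂ] E := (exists_hasDerivAt_lieAd E H).choose

variable (H) in
theorem hasDerivAt_lieAd_zero (ξ η : E) :
    HasDerivAt (fun s : ℝ => lieAd (lieExp (s • ξ) : H) η) (lieAdDeriv E H ξ η) 0 :=
  (exists_hasDerivAt_lieAd E H).choose_spec ξ η

variable (H) in
theorem hasDerivAt_lieAd (ξ η : E) (t : ℝ) :
    HasDerivAt (fun s : ℝ => lieAd (lieExp (s • ξ) : H) η)
      (lieAd (lieExp (t • ξ) : H) (lieAdDeriv E H ξ η)) t := by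
  have h0 : HasDerivAt (fun s : ℝ => lieAd (lieExp ((s - t) • ξ) : H) η)
      (lieAdDeriv E H ξ η) t :=
    HasDerivAt.comp_sub_const t t (by simpa using hasDerivAt_lieAd_zero H ξ η)
  have h1 := HasFDerivAt.comp_hasDerivAt (x := t)
    ((lieAd (lieExp (t • ξ) : H) : E →L[ℂ] E).restrictScalars ℝ).hasFDerivAt h0
  refine h1.congr_of_eventuallyEq (.of_forall fun s => ?_)
  have : (lieExp (s • ξ) : H) = lieExp (t • ξ) * lieExp ((s - t) • ξ) := by
    rw [← lieExp_add_smul, add_sub_cancel]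
  simp only [this, lieAd_mul]
  rfl

theorem lieAdDeriv_mem_lieAlg {S : Subgroup H} (hS : IsClosed (S : Set H)) {ξ η : E}
    (hξ : ξ ∈ lieAlg S) (hη : η ∈ lieAlg S) : lieAdDeriv E H ξ η ∈ lieAlg S := by
  have : FiniteDimensional ℝ E := FiniteDimensional.complexToReal E
  exact (hasDerivAt_lieAd_zero H ξ η).mem_of_isClosed_submodule (W := lieAlgSubmodule S hS)
    (Submodule.closed_of_finiteDimensional _) fun s => lieAd_mem_lieAlg (hξ s) hη

/-- The curve `exp (-c s) • Ad (exp (s ξ)) η` has zero derivative. -/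
theorem lieAd_lieExp_of_eigenvector {ξ η : E} {c : ℝ} (h : lieAdDeriv E H ξ η = c • η) (t : ℝ) :
    lieAd (lieExp (t • ξ) : H) η = Real.exp (c * t) • η := by
  have h1 : ∀ s : ℝ, HasDerivAt
      (fun s : ℝ => Real.exp (-(c * s)) • lieAd (lieExp (s • ξ) : H) η) 0 s := by
    intro s
    have h2 : HasDerivAt (fun s : ℝ => Real.exp (-(c * s))) (Real.exp (-(c * s)) * -(c * 1)) s :=
      ((hasDerivAt_id s).const_mul c).neg.exp
    refine (h2.smul (hasDerivAt_lieAd H ξ η s)).congr_deriv ?_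
    rw [h, ContinuousLinearMap.map_smul_of_tower, smul_smul, ← add_smul]
    ring_nf
    simp
  have h3 := is_const_of_deriv_eq_zero (fun s => (h1 s).differentiableAt)
    (fun s => (h1 s).deriv) t 0
  simp only [mul_zero, neg_zero, Real.exp_zero, zero_smul, lieExp_zero, lieAd_one, one_smul] at h3
  conv_rhs => rw [← h3, smul_smul, ← Real.exp_add, add_neg_cancel, Real.exp_zero, one_smul]

omit [FiniteDimensional ℂ E] in
theorem mem_I_smul_iff {A : Set E} {α : E} : α ∈ Complex.I • A ↔ ∃ η ∈ A, Complex.I • η = α :=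
  Set.mem_smul_set

variable {U : Subgroup H}

theorem lieAd_mem_I_smul {u : H} (hu : u ∈ U) {α : E} (hα : α ∈ Complex.I • lieAlg U) :
    lieAd u α ∈ Complex.I • lieAlg U := by
  obtain ⟨η, hη, rfl⟩ := mem_I_smul_iff.1 hα
  exact mem_I_smul_iff.2 ⟨lieAd u η, lieAd_mem_lieAlg hu hη, by simp⟩

theorem lieAdDeriv_mem_I_smul (hU : IsClosed (U : Set H)) {η α : E} (hη : η ∈ lieAlg U)
    (hα : α ∈ Complex.I • lieAlg U) : lieAdDeriv E H η α ∈ Complex.I • lieAlg U := by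
  obtain ⟨ζ, hζ, rfl⟩ := mem_I_smul_iff.1 hα
  exact mem_I_smul_iff.2 ⟨lieAdDeriv E H η ζ, lieAdDeriv_mem_lieAlg hU hη hζ, by simp⟩

/-- By complex bilinearity `[iη, iζ] = -[η, ζ]`. -/
theorem lieAdDeriv_I_smul_mem (hU : IsClosed (U : Set H)) {β α : E}
    (hβ : β ∈ Complex.I • lieAlg U) (hα : α ∈ Complex.I • lieAlg U) :
    lieAdDeriv E H β α ∈ lieAlg U := by
  obtain ⟨η, hη, rfl⟩ := mem_I_smul_iff.1 hβ
  obtain ⟨ζ, hζ, rfl⟩ := mem_I_smul_iff.1 hα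
  have h : lieAdDeriv E H (Complex.I • η) (Complex.I • ζ) = -lieAdDeriv E H η ζ := by
    simp [smul_smul]
  rw [h]
  exact (lieAlgSubmodule U hU).neg_mem (lieAdDeriv_mem_lieAlg hU hη hζ)

/-- Obtained by differentiating `B (Ad u α) α' = B α (Ad u⁻¹ α')` along `u = exp (s η)`. -/
theorem IsInvariantInner.lieAdDeriv_skew {B : E →ₗ[ℝ] E →ₗ[ℝ] ℝ} (hB : IsInvariantInner U B)
    {η α α' : E} (hη : η ∈ lieAlg U) (hα : α ∈ Complex.I • lieAlg U)
    (hα' : α' ∈ Complex.I • lieAlg U) :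
    B (lieAdDeriv E H η α) α' = -B α (lieAdDeriv E H η α') := by
  have : FiniteDimensional ℝ E := FiniteDimensional.complexToReal E
  have h1 : HasDerivAt (fun s : ℝ => B (lieAd (lieExp (s • η) : H) α) α')
      (B (lieAdDeriv E H η α) α') 0 :=
    HasFDerivAt.comp_hasDerivAt (x := (0 : ℝ))
      (LinearMap.toContinuousLinearMap (B.flip α')).hasFDerivAt (hasDerivAt_lieAd_zero H η α)
  have h2 : HasDerivAt (fun s : ℝ => B α (lieAd (lieExp (s • -η) : H) α'))
      (B α (lieAdDeriv E H (-η) α')) 0 :=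
    HasFDerivAt.comp_hasDerivAt (x := (0 : ℝ))
      (LinearMap.toContinuousLinearMap (B α)).hasFDerivAt (hasDerivAt_lieAd_zero H (-η) α')
  have h3 : ∀ s : ℝ, B (lieAd (lieExp (s • η) : H) α) α' =
      B α (lieAd (lieExp (s • -η) : H) α') := by
    intro s
    have hs : (lieExp (s • -η) : H) ∈ U := by
      rw [smul_neg, lieExp_neg]
      exact U.inv_mem (hη s)
    rw [← hB.invariant _ hs _ (lieAd_mem_I_smul (hη s) hα) _ hα', ← lieAd_mul, smul_neg, lieExp_neg,
      inv_mul_cancel, lieAd_one]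
  simp only [h3] at h1
  rw [h1.unique h2]
  simp

end Adjoint

/-! ### The subspace `𝔭` and the square of `ad β` -/

section CompatibleSubgroup

variable {E : Type*} [NormedAddCommGroup E] [NormedSpace ℂ E] [FiniteDimensional ℂ E]
  {H : Type*} [TopologicalSpace H] [T2Space H] [ChartedSpace E H] [Group H]
  [LieGroup 𝓘(ℂ, E) ω H]

variable (E) in
/-- The real subspace `𝔭 = 𝔤 ∩ i𝔲`. -/
def cartanPSubmodule (U G : Subgroup H) (hU : IsClosed (U : Set H)) (hG : IsClosed (G : Set H)) :
    Submodule ℝ E where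
  carrier := cartanP U G
  add_mem' {a b} ha hb := by
    refine ⟨add_mem_lieAlg hG ha.1 hb.1, ?_⟩
    obtain ⟨η, hη, rfl⟩ := mem_I_smul_iff.1 ha.2
    obtain ⟨ζ, hζ, rfl⟩ := mem_I_smul_iff.1 hb.2
    exact mem_I_smul_iff.2 ⟨η + ζ, add_mem_lieAlg hU hη hζ, smul_add _ _ _⟩
  zero_mem' := ⟨(lieAlgSubmodule G hG).zero_mem,
    mem_I_smul_iff.2 ⟨0, (lieAlgSubmodule U hU).zero_mem, smul_zero _⟩⟩
  smul_mem' t a ha := by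
    refine ⟨smul_mem_lieAlg ha.1 t, ?_⟩
    obtain ⟨η, hη, rfl⟩ := mem_I_smul_iff.1 ha.2
    exact mem_I_smul_iff.2 ⟨t • η, smul_mem_lieAlg hη t, smul_comm _ _ _⟩

variable {U G : Subgroup H}

theorem lieAdDeriv_lieAdDeriv_mem_cartanP (hU : IsClosed (U : Set H)) (hG : IsClosed (G : Set H))
    {β α : E} (hβ : β ∈ cartanP U G) (hα : α ∈ cartanP U G) :
    lieAdDeriv E H β (lieAdDeriv E H β α) ∈ cartanP U G := by
  refine ⟨lieAdDeriv_mem_lieAlg hG hβ.1 (lieAdDeriv_mem_lieAlg hG hβ.1 hα.1), ?_⟩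
  obtain ⟨η, hη, hηβ⟩ := mem_I_smul_iff.1 hβ.2
  refine mem_I_smul_iff.2 ⟨lieAdDeriv E H η (lieAdDeriv E H β α),
    lieAdDeriv_mem_lieAlg hU hη (lieAdDeriv_I_smul_mem hU hβ.2 hα.2), ?_⟩
  rw [← hηβ, map_smul]
  rfl

/-- On `i𝔲` the square of `ad β`, `β = iη`, is minus the square of the skew operator `ad η`. -/
theorem IsInvariantInner.lieAdDeriv_sq {B : E →ₗ[ℝ] E →ₗ[ℝ] ℝ} (hB : IsInvariantInner U B)
    (hU : IsClosed (U : Set H)) {η α α' : E} (hη : η ∈ lieAlg U)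
    (hα : α ∈ Complex.I • lieAlg U) (hα' : α' ∈ Complex.I • lieAlg U) :
    B (lieAdDeriv E H (Complex.I • η) (lieAdDeriv E H (Complex.I • η) α)) α' =
      B (lieAdDeriv E H η α) (lieAdDeriv E H η α') := by
  have h : lieAdDeriv E H (Complex.I • η) (lieAdDeriv E H (Complex.I • η) α) =
      -lieAdDeriv E H η (lieAdDeriv E H η α) := by
    simp [smul_smul]
  rw [h, map_neg, LinearMap.neg_apply,
    hB.lieAdDeriv_skew hη (lieAdDeriv_mem_I_smul hU hη hα) hα', neg_neg]

end CompatibleSubgroup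

/-! ### Monotonicity of the momentum map and its maxima -/

section Momentum

variable {E : Type*} [NormedAddCommGroup E] [NormedSpace ℂ E] [FiniteDimensional ℂ E]
  {H : Type*} [TopologicalSpace H] [T2Space H] [ChartedSpace E H] [Group H]
  [LieGroup 𝓘(ℂ, E) ω H]
  {F : Type*} [NormedAddCommGroup F] [NormedSpace ℂ F]
  {Z : Type*} [TopologicalSpace Z] [ChartedSpace F Z] [IsManifold 𝓘(ℂ, F) ω Z]
  [MulAction H Z] {U : Subgroup H} {g : RealMetric F Z} {B : E →ₗ[ℝ] E →ₗ[ℝ] ℝ} {μ : Z → E}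

theorem metricAt_self_pos (g : RealMetric F Z) (z : Z) {v : F} (hv : v ≠ 0) :
    0 < metricAt g z v v := g.pos z v hv

theorem metricAt_zero_left (g : RealMetric F Z) (z : Z) (v : F) : metricAt g z 0 v = 0 := by
  have : g.inner z (0 : TangentSpace 𝓘(ℝ, F) z) = 0 := map_zero _
  exact congrArg (fun L : F →L[ℝ] ℝ => L v) this

theorem metricAt_self_nonneg (g : RealMetric F Z) (z : Z) (v : F) : 0 ≤ metricAt g z v v := by
  by_cases hv : v = 0
  · rw [hv, metricAt_zero_left]
  · exact (metricAt_self_pos g z hv).le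

theorem eq_zero_of_metricAt_self (g : RealMetric F Z) {z : Z} {v : F}
    (h : metricAt g z v v = 0) : v = 0 := by
  by_contra hv
  exact (metricAt_self_pos g z hv).ne' h

variable (hact : IsSmoothAction E H F Z) (hμ : IsMomentumMap U B g μ)
include hact hμ

theorem IsMomentumMap.hasDerivAt {c : ℝ → Z} {t : ℝ} {v : F} (hc : HasVelocityAt c t v) {α : E}
    (hα : α ∈ Complex.I • lieAlg U) :
    HasDerivAt (fun s => B (μ (c s)) α) (metricAt g (c t) (orbitDeriv E H F (c t) α) v) t := by
  have : FiniteDimensional ℝ E := FiniteDimensional.complexToReal E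
  have h1 : MDifferentiableAt 𝓘(ℝ, F) 𝓘(ℝ, ℝ) (fun y : Z => B (μ y) α) (c t) :=
    MDifferentiableAt.comp (I' := 𝓘(ℝ, E)) (g := fun m => B m α) (c t)
      (LinearMap.toContinuousLinearMap (B.flip α)).differentiableAt.mdifferentiableAt
      (hμ.smooth.mdifferentiable (by simp) _)
  have h2 := hasVelocityAt_iff_hasDerivAt.1 (hc.comp_mdifferentiableAt rfl h1)
  have h3 := hμ.grad α hα (c t) v
  rw [hact.fundamentalField_eq] at h3
  exact h3 ▸ h2

theorem IsMomentumMap.hasDerivAt_lieExp {α : E} (hα : α ∈ Complex.I • lieAlg U) (z : Z) (t : ℝ) :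
    HasDerivAt (fun s : ℝ => B (μ ((lieExp (s • α) : H) • z)) α)
      (metricAt g ((lieExp (t • α) : H) • z)
        (orbitDeriv E H F ((lieExp (t • α) : H) • z) α)
        (orbitDeriv E H F ((lieExp (t • α) : H) • z) α)) t :=
  hμ.hasDerivAt hact (hact.hasVelocityAt_lieExp α z t) hα

/-- `μ^α` is monotone along the flow of `α`. -/
theorem IsMomentumMap.monotone_lieExp {α : E} (hα : α ∈ Complex.I • lieAlg U) (z : Z) :
    Monotone (fun s : ℝ => B (μ ((lieExp (s • α) : H) • z)) α) :=
  monotone_of_hasDerivAt_nonneg (hμ.hasDerivAt_lieExp hact hα z)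
    fun _ => metricAt_self_nonneg _ _ _

/-- A point at which `μ^α` attains its maximum along the flow of `α` is fixed by the flow. -/
theorem IsMomentumMap.orbitDeriv_eq_zero_of_forall_le {α : E} (hα : α ∈ Complex.I • lieAlg U)
    {z : Z} (h : ∀ s : ℝ, B (μ ((lieExp (s • α) : H) • z)) α ≤ B (μ z) α) :
    orbitDeriv E H F z α = 0 := by
  have h1 := hμ.hasDerivAt_lieExp hact hα z 0
  have h2 : IsLocalMax (fun s : ℝ => B (μ ((lieExp (s • α) : H) • z)) α) 0 :=
    .of_forall fun s => by simpa [lieExp_zero] using h s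
  have h3 := h2.hasDerivAt_eq_zero h1
  simp only [zero_smul, lieExp_zero, one_smul] at h3
  exact eq_zero_of_metricAt_self g h3

variable [T2Space Z] {X : Set Z} {y : Z} {β : E}

/-- If `y` maximizes `μ^β` on an invariant set, eigenvectors of `ad β` with positive eigenvalue
fix `y`. -/
theorem IsMomentumMap.orbitDeriv_eq_zero_of_eigenvector {G : Subgroup H}
    (hX : ∀ a ∈ G, ∀ x ∈ X, a • x ∈ X) (hy : y ∈ X) (hβ : β ∈ cartanP U G)
    (hmax : ∀ w ∈ X, B (μ w) β ≤ B (μ y) β) {ξ : E} (hξ : ξ ∈ lieAlg G) {c : ℝ} (hc : 0 < c)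
    (h : lieAdDeriv E H β ξ = c • ξ) : orbitDeriv E H F y ξ = 0 := by
  have : FiniteDimensional ℝ E := FiniteDimensional.complexToReal E
  have hβy : ∀ s : ℝ, (lieExp (s • β) : H) • y = y :=
    hact.lieExp_smul_eq_self (hμ.orbitDeriv_eq_zero_of_forall_le hact hβ.2
      fun s => hmax _ (hX _ (hβ.1 s) _ hy))
  have key : ∀ t : ℝ, (lieExp (t • ξ) : H) • y = y := by
    intro t
    set w := (lieExp (t • ξ) : H) • y with hw
    have hwX : ∀ s : ℝ, (lieExp (s • β) : H) • w ∈ X :=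
      fun s => hX _ (hβ.1 s) _ (hX _ (hξ t) _ hy)
    -- As `β` fixes `y`, conjugating `exp (t ξ)` by `exp (s β)` only rescales `t` by `exp (c s)`,
    -- which tends to zero as `s → -∞`.
    have hflow : ∀ s : ℝ, (lieExp (s • β) : H) • w =
        (lieExp ((t * Real.exp (c * s)) • ξ) : H) • y := by
      intro s
      rw [mul_smul, ← lieAd_lieExp_of_eigenvector h s, lieExp_smul_lieAd, mul_smul, mul_smul,
        ← lieExp_neg, ← neg_smul, hβy]
    have hlim : Filter.Tendsto (fun s : ℝ => (lieExp (s • β) : H) • w) Filter.atBot (𝓝 y) := by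
      have h1 : Filter.Tendsto (fun s : ℝ => t * Real.exp (c * s)) Filter.atBot (𝓝 (t * 0)) :=
        ((Real.tendsto_exp_atBot.comp (Filter.tendsto_id.const_mul_atBot hc)).const_mul t)
      rw [mul_zero] at h1
      have h2 := ((hact.continuous_lieExp_smul ξ y).tendsto 0).comp h1
      simp only [zero_smul, lieExp_zero, one_smul] at h2
      exact h2.congr fun s => (hflow s).symm
    have hcont : Continuous fun z : Z => B (μ z) β :=
      (LinearMap.toContinuousLinearMap (B.flip β)).continuous.comp hμ.smooth.continuous
    -- A monotone function is bounded below by its limit at `-∞`, here `μ^β (y)`.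
    have hle : ∀ s : ℝ, B (μ y) β ≤ B (μ ((lieExp (s • β) : H) • w)) β := fun s =>
      (hμ.monotone_lieExp hact hβ.2 w).le_of_tendsto ((hcont.tendsto y).comp hlim) s
    have hw0 : orbitDeriv E H F w β = 0 := by
      refine hμ.orbitDeriv_eq_zero_of_forall_le hact hβ.2 fun s => ?_
      have := hle 0
      rw [zero_smul, lieExp_zero, one_smul] at this
      exact (hmax _ (hwX s)).trans this
    -- The curve that converges to `y` is constantly `w`, so `w = y`.
    have hconst := hact.lieExp_smul_eq_self hw0
    simp only [hconst] at hlim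
    exact tendsto_nhds_unique tendsto_const_nhds hlim
  have h1 := hact.hasVelocityAt_lieExp_zero ξ y
  simp only [key] at h1
  exact h1.unique (hasVelocityAt_const y 0)

end Momentum

/-! ### The point of maximal norm and its orbit -/

section CompactOrbit

variable {E : Type*} [NormedAddCommGroup E] [NormedSpace ℂ E] [FiniteDimensional ℂ E]
  {H : Type*} [TopologicalSpace H] [T2Space H] [ChartedSpace E H] [Group H]
  [LieGroup 𝓘(ℂ, E) ω H]
  {F : Type*} [NormedAddCommGroup F] [NormedSpace ℂ F]
  {Z : Type*} [TopologicalSpace Z] [T2Space Z] [ChartedSpace F Z] [IsManifold 𝓘(ℂ, F) ω Z]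
  [MulAction H Z] {U G : Subgroup H} {g : RealMetric F Z} {B : E →ₗ[ℝ] E →ₗ[ℝ] ℝ} {μ : Z → E}

/-- The `B`-orthogonal projection to `𝔭`. -/
theorem IsInvariantInner.exists_projection (hB : IsInvariantInner U B) (hU : IsClosed (U : Set H))
    (hG : IsClosed (G : Set H)) :
    ∃ P : E →ₗ[ℝ] cartanPSubmodule E U G hU hG, ∀ m, ∀ α ∈ cartanP U G, B (P m : E) α = B m α := by
  have : FiniteDimensional ℝ E := FiniteDimensional.complexToReal E
  set p := cartanPSubmodule E U G hU hG
  obtain ⟨P, hP⟩ := exists_riesz (V := p) (b := B.domRestrict₁₂ p p)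
    (fun v hv => hB.pos v v.2.2 (by simpa using hv)) (B.domRestrict₂ p)
  exact ⟨P, fun m α hα => hP m ⟨α, hα⟩⟩

/-- At a point of an invariant set where the norm of the `𝔭`-component of `μ` is maximal, the
directions in `𝔭` are tangent to the orbit of `K = U ∩ G`. -/
theorem IsMomentumMap.exists_orbitDeriv_eq (hact : IsSmoothAction E H F Z)
    (hμ : IsMomentumMap U B g μ) (hB : IsInvariantInner U B) (hU : IsClosed (U : Set H))
    (hG : IsClosed (G : Set H)) {P : E →ₗ[ℝ] cartanPSubmodule E U G hU hG}
    (hP : ∀ m, ∀ α ∈ cartanP U G, B (P m : E) α = B m α) {X : Set Z}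
    (hX : ∀ a ∈ G, ∀ x ∈ X, a • x ∈ X) {y : Z} (hy : y ∈ X)
    (hmax : ∀ w ∈ X, B (P (μ w) : E) (P (μ w) : E) ≤ B (P (μ y) : E) (P (μ y) : E)) {α : E}
    (hα : α ∈ cartanP U G) :
    ∃ κ ∈ lieAlg (U ⊓ G), orbitDeriv E H F y α = orbitDeriv E H F y κ := by
  have : FiniteDimensional ℝ E := FiniteDimensional.complexToReal E
  let p := cartanPSubmodule E U G hU hG
  set β : E := (P (μ y)).1
  have hβ : β ∈ cartanP U G := (P (μ y)).2
  have hyβ : B (μ y) β = B β β := (hP _ _ hβ).symm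
  have hdist : ∀ w, B ((P (μ w) : E) - β) ((P (μ w) : E) - β) =
      B (P (μ w) : E) (P (μ w) : E) - 2 * B (μ w) β + B β β := by
    intro w
    have h1 := hP (μ w) β hβ
    have h2 := hB.symm β hβ.2 (P (μ w) : E) (P (μ w)).2.2
    simp only [map_sub, LinearMap.sub_apply]
    linarith
  have hnonneg : ∀ v ∈ cartanP U G, 0 ≤ B v v := fun v hv => by
    by_cases h0 : v = 0
    · simp [h0]
    · exact (hB.pos v hv.2 h0).le
  have hsub : ∀ w, (P (μ w) : E) - β ∈ cartanP U G := fun w => p.sub_mem (P (μ w)).2 hβ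
  have hle : ∀ w ∈ X, B (μ w) β ≤ B (μ y) β := by
    intro w hw
    have h1 := hdist w
    have h2 := hnonneg _ (hsub w)
    have h3 := hmax w hw
    linarith
  have heq : ∀ w ∈ X, B (μ w) β = B (μ y) β → (P (μ w) : E) = β := by
    intro w hw hwβ
    by_contra hne
    have h1 := hdist w
    have h2 := hB.pos _ (hsub w).2 (sub_ne_zero.2 hne)
    have h3 := hmax w hw
    linarith
  obtain ⟨η, hη, hηβ⟩ := mem_I_smul_iff.1 hβ.2
  -- the square of `ad β` on `𝔭`
  let S : p →ₗ[ℝ] p :=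
    { toFun := fun v => ⟨lieAdDeriv E H β (lieAdDeriv E H β v),
        lieAdDeriv_lieAdDeriv_mem_cartanP hU hG hβ v.2⟩
      map_add' := fun v w => by ext; simp
      map_smul' := fun c v => by
        ext
        simp [ContinuousLinearMap.map_smul_of_tower] }
  let T : E →ₗ[ℝ] F := (orbitDeriv E H F y).toLinearMap
  have hK : IsClosed ((U ⊓ G : Subgroup H) : Set H) := hU.inter hG
  -- The elements of `𝔭` whose field at `y` is tangent to the `K`-orbit; the goal is `W = ⊤`.
  let W : Submodule ℝ p := (((lieAlgSubmodule (U ⊓ G) hK).map T).comap T).comap p.subtype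
  have hsq : ∀ v w : p, B (S v : E) (w : E) = B (lieAdDeriv E H η v) (lieAdDeriv E H η w) := by
    intro v w
    rw [← hB.lieAdDeriv_sq hU hη v.2.2 w.2.2, hηβ]
    rfl
  have hIu : ∀ v : p, lieAdDeriv E H η v ∈ Complex.I • lieAlg U :=
    fun v => lieAdDeriv_mem_I_smul hU hη v.2.2
  have hW : W = ⊤ := by
    refine eq_top_of_forall_eigenvector_mem (b := B.domRestrict₁₂ p p)
      (fun v w => hB.symm v v.2.2 w w.2.2) (fun v hv => hB.pos v v.2.2 (by simpa using hv)) S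
      (fun v w => ?_) W fun c v hv => ?_
    · change B (S v : E) (w : E) = B (v : E) (S w : E)
      rw [hB.symm v v.2.2 (S w) (S w).2.2, hsq, hsq, hB.symm _ (hIu v) _ (hIu w)]
    · have hv' : lieAdDeriv E H β (lieAdDeriv E H β v) = c • (v : E) := congrArg Subtype.val hv
      have hvp : (v : E) ∈ cartanP U G := v.2
      have hcv : c * B v v = B (lieAdDeriv E H η v) (lieAdDeriv E H η v) := by
        rw [← hsq, hv]
        simp
      change ∃ κ ∈ lieAlg (U ⊓ G), T κ = T v
      -- Splitting on `[η, v]` instead of on `c` puts `v = 0`, where `c` is arbitrary, into the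
      -- first case.
      by_cases hηv : lieAdDeriv E H η v = 0
      · -- `exp (t v)` commutes with `exp (s β)`
        have hβv : lieAdDeriv E H β v = (0 : ℝ) • (v : E) := by
          rw [← hηβ]
          simp [hηv]
        have hcomm : ∀ s t : ℝ, (lieExp (s • β) : H) • (lieExp (t • (v : E)) : H) • y =
            (lieExp (t • (v : E)) : H) • (lieExp (s • β) : H) • y := by
          intro s t
          have h1 := lieExp_smul_lieAd (lieExp (s • β) : H) (v : E) t
          rw [lieAd_lieExp_of_eigenvector hβv] at h1
          simp only [zero_mul, Real.exp_zero, one_smul] at h1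
          rw [smul_smul, smul_smul]
          conv_rhs => rw [h1]
          group
        have hβy : ∀ s : ℝ, (lieExp (s • β) : H) • y = y :=
          hact.lieExp_smul_eq_self (hμ.orbitDeriv_eq_zero_of_forall_le hact hβ.2
            fun s => hle _ (hX _ (hβ.1 s) _ hy))
        have hw0 : ∀ t : ℝ, orbitDeriv E H F ((lieExp (t • (v : E)) : H) • y) β = 0 := by
          intro t
          refine hμ.orbitDeriv_eq_zero_of_forall_le hact hβ.2 fun s => ?_
          rw [hcomm, hβy]
        have hconst : ∀ t : ℝ, B (μ ((lieExp (t • (v : E)) : H) • y)) β = B (μ y) β := by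
          intro t
          have h1 : ∀ s, HasDerivAt
              (fun s : ℝ => B (μ ((lieExp (s • (v : E)) : H) • y)) β) 0 s := by
            intro s
            have h2 := hμ.hasDerivAt hact (hact.hasVelocityAt_lieExp (v : E) y s) hβ.2
            rwa [hw0, metricAt_zero_left] at h2
          have h3 := is_const_of_deriv_eq_zero (fun s => (h1 s).differentiableAt)
            (fun s => (h1 s).deriv) t 0
          simpa [lieExp_zero] using h3
        -- All points `exp (s v) y` maximize `μ^β`, so `P ∘ μ` equals `β` on them and `μ^v` is
        -- constant along the flow of `v`.
        have hvy : orbitDeriv E H F y v = 0 := by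
          refine hμ.orbitDeriv_eq_zero_of_forall_le hact hvp.2 fun s => ?_
          rw [← hP _ _ hvp, ← hP (μ y) _ hvp, heq _ (hX _ (hvp.1 s) _ hy) (hconst s)]
        exact ⟨0, (lieAlgSubmodule (U ⊓ G) hK).zero_mem, by rw [map_zero]; exact hvy.symm⟩
      · have hv0 : (v : E) ≠ 0 := fun h => hηv (by rw [h, map_zero])
        have hc : 0 < c := by
          have h1 := hB.pos _ (hIu v) hηv
          have h2 := hB.pos _ hvp.2 hv0
          rw [← hcv] at h1
          exact pos_of_mul_pos_left h1 h2.le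
        have hs : 0 < √c := Real.sqrt_pos.2 hc
        have hβvG := lieAdDeriv_mem_lieAlg hG hβ.1 hvp.1
        have hβvU := lieAdDeriv_I_smul_mem hU hβ.2 hvp.2
        -- From `[β, [β, v]] = c v`, this vector is an eigenvector of `ad β` with eigenvalue `√c >
        -- 0`.
        have h1 : orbitDeriv E H F y ((v : E) + (√c)⁻¹ • lieAdDeriv E H β v) = 0 := by
          refine hμ.orbitDeriv_eq_zero_of_eigenvector hact hX hy hβ hle
            (add_mem_lieAlg hG hvp.1 (smul_mem_lieAlg hβvG _)) hs ?_
          rw [map_add, ContinuousLinearMap.map_smul_of_tower, hv', smul_add, smul_smul, smul_smul,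
            mul_inv_cancel₀ hs.ne', one_smul, add_comm]
          congr 2
          nth_rewrite 2 [← Real.mul_self_sqrt hc.le]
          field_simp
        refine ⟨-((√c)⁻¹ • lieAdDeriv E H β v), (lieAlgSubmodule (U ⊓ G) hK).neg_mem
          (smul_mem_lieAlg (S := U ⊓ G) (fun t => ⟨hβvU t, hβvG t⟩) _), ?_⟩
        rw [map_add] at h1
        rw [map_neg]
        exact (eq_neg_of_add_eq_zero_left h1).symm
  have h1 : (⟨α, hα⟩ : p) ∈ W := hW ▸ Submodule.mem_top
  obtain ⟨κ, hκ, h2⟩ : ∃ κ ∈ lieAlg (U ⊓ G), T κ = T α := h1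
  exact ⟨κ, hκ, h2.symm⟩

/-- If `𝔭` is tangent to the `K`-orbit of `y`, `K = U ∩ G` compact, then the `G`-orbit of `y` is
the `K`-orbit. -/
theorem IsCompatible.orbit_eq [FiniteDimensional ℂ F] (hact : IsSmoothAction E H F Z)
    (hU : IsCompact (U : Set H)) (hG : IsCompatible E U G) {y : Z}
    (hy : ∀ α ∈ cartanP U G, ∃ κ ∈ lieAlg (U ⊓ G),
      orbitDeriv E H F y α = orbitDeriv E H F y κ) :
    IsCompact (orbit (U ⊓ G : Subgroup H) y) ∧ orbit G y = orbit (U ⊓ G : Subgroup H) y := by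
  have hK : IsCompact ((U ⊓ G : Subgroup H) : Set H) := hU.inter_right hG.isClosed
  have horb : orbit (U ⊓ G : Subgroup H) y =
      (fun h : H => h • y) '' ((U ⊓ G : Subgroup H) : Set H) := by
    ext w
    constructor
    · rintro ⟨k, rfl⟩
      exact ⟨k, k.2, rfl⟩
    · rintro ⟨k, hk, rfl⟩
      exact ⟨⟨k, hk⟩, rfl⟩
  have hC : IsCompact (orbit (U ⊓ G : Subgroup H) y) := by
    rw [horb]
    exact hK.image (hact.mdifferentiable_orbit y).continuous
  refine ⟨hC, Subset.antisymm ?_ ?_⟩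
  · rintro _ ⟨⟨a, ha⟩, rfl⟩
    obtain ⟨⟨k, α⟩, ⟨hk, hα⟩, rfl⟩ := hG.bijOn.surjOn ha
    have h1 : (lieExp ((1 : ℝ) • α) : H) • y ∈ orbit (U ⊓ G : Subgroup H) y := by
      refine hact.lieExp_smul_mem_of_tangent hC.isClosed ?_ (mem_orbit_self y) zero_le_one
      rintro _ ⟨⟨k, hk⟩, rfl⟩
      -- Tangency at `k • y` is tangency at `y` for `Ad k⁻¹ α ∈ 𝔭`, carried over by `k`.
      obtain ⟨κ, hκ, hκα⟩ := hy (lieAd k⁻¹ α)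
        ⟨lieAd_mem_lieAlg (G.inv_mem hk.2) hα.1, lieAd_mem_I_smul (U.inv_mem hk.1) hα.2⟩
      have h2 := (hact.hasVelocityAt_lieExp_zero κ y).comp_mdifferentiableAt rfl
        (hact.mdifferentiable_smul k _)
      have h3 := (hact.hasVelocityAt_lieExp_zero (lieAd k⁻¹ α) y).comp_mdifferentiableAt rfl
        (hact.mdifferentiable_smul k _)
      have h4 := hact.hasVelocityAt_lieExp_zero α (k • y)
      have h5 : (fun s : ℝ => k • (lieExp (s • lieAd k⁻¹ α) : H) • y) =
          fun s : ℝ => (lieExp (s • α) : H) • k • y := by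
        ext s
        rw [lieExp_smul_lieAd, smul_smul, smul_smul]
        group
      simp only [zero_smul, lieExp_zero, one_smul] at h2 h3
      rw [h5, hκα] at h3
      refine ⟨fun s => k • (lieExp (s • κ) : H) • y, ?_, ?_, fun s => ?_⟩
      · simp [lieExp_zero]
      · exact h3.unique h4 ▸ h2
      · exact ⟨⟨k * lieExp (s • κ), (U ⊓ G).mul_mem hk (hκ s)⟩, mul_smul _ _ _⟩
    rw [one_smul] at h1
    obtain ⟨k', hk'⟩ := h1
    refine ⟨⟨k, hk⟩ * k', ?_⟩
    change (k * (k' : H)) • y = (k * lieExp α) • y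
    rw [mul_smul, mul_smul]
    exact congrArg (fun z => k • z) hk'
  · rintro _ ⟨⟨k, hk⟩, rfl⟩
    exact ⟨⟨k, hk.2⟩, rfl⟩

/-- Every nonempty compact `G`-invariant set contains a compact `G`-orbit that is a `K`-orbit,
`K = U ∩ G`. -/
theorem IsMomentumMap.exists_orbit_eq [FiniteDimensional ℂ F] (hact : IsSmoothAction E H F Z)
    (hμ : IsMomentumMap U B g μ) (hB : IsInvariantInner U B) (hU : IsCompact (U : Set H))
    (hG : IsCompatible E U G) {X : Set Z} (hXc : IsCompact X) (hXne : X.Nonempty)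
    (hX : ∀ a ∈ G, ∀ x ∈ X, a • x ∈ X) :
    ∃ y ∈ X, IsCompact (orbit G y) ∧ orbit G y = orbit (U ⊓ G : Subgroup H) y := by
  have : FiniteDimensional ℝ E := FiniteDimensional.complexToReal E
  obtain ⟨P, hP⟩ := hB.exists_projection hU.isClosed hG.isClosed
  set P' : E →ₗ[ℝ] E := (Submodule.subtype _) ∘ₗ P with hP'
  let Q : E →ₗ[ℝ] E →ₗ[ℝ] ℝ := B.compl₁₂ P' P'
  have hQ : Continuous fun w => Q (μ w) (μ w) := by
    have h1 : Continuous fun m => LinearMap.toContinuousLinearMap (Q m) :=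
      (LinearMap.continuous_of_finiteDimensional
        (LinearMap.toContinuousLinearMap.toLinearMap ∘ₗ Q))
    exact (h1.comp hμ.smooth.continuous).clm_apply hμ.smooth.continuous
  obtain ⟨y, hy, hmax⟩ := hXc.exists_isMaxOn hXne hQ.continuousOn
  obtain ⟨hc, he⟩ := hG.orbit_eq hact hU fun α hα =>
    hμ.exists_orbitDeriv_eq hact hB hU.isClosed hG.isClosed hP hX hy (fun w hw => hmax hw) hα
  exact ⟨y, hy, he ▸ hc, he⟩

end CompactOrbit

end

/-- `H = U^ℂ` acts holomorphically on the Kähler manifold `Z` with momentum map `μ` for the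
`U`-action, and `G` is a compatible closed real subgroup, `K = U ∩ G`. -/
theorem lemma7p2
    {E : Type*} [NormedAddCommGroup E] [NormedSpace ℂ E] [FiniteDimensional ℂ E]
    {H : Type*} [TopologicalSpace H] [T2Space H] [ChartedSpace E H] [Group H]
    [LieGroup 𝓘(ℂ, E) ω H]
    {F : Type*} [NormedAddCommGroup F] [NormedSpace ℂ F] [FiniteDimensional ℂ F]
    {Z : Type*} [TopologicalSpace Z] [T2Space Z] [ChartedSpace F Z] [IsManifold 𝓘(ℂ, F) ω Z]
    [MulAction H Z]
    (hact : ContMDiff (𝓘(ℂ, E).prod 𝓘(ℂ, F)) 𝓘(ℂ, F) ω (fun q : H × Z => q.1 • q.2))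
    (U : Subgroup H) (hU : IsComplexification E U)
    (g : RealMetric F Z) (hg : IsKaehler g) (hgU : MetricInvariant U g)
    (B : E →ₗ[ℝ] E →ₗ[ℝ] ℝ) (hB : IsInvariantInner U B)
    (μ : Z → E) (hμ : IsMomentumMap U B g μ)
    (G : Subgroup H) (hG : IsCompatible E U G) :
    (∀ X : Set Z, IsCompact X → (∀ a ∈ G, ∀ x ∈ X, a • x ∈ X) →
      ∀ x ∈ X, ∃ y : Z, orbit G y ⊆ closure (orbit G x) ∧ IsCompact (orbit G y)) ∧
    (∀ z : Z, IsCompact (orbit G z) → ∃ y : Z, orbit G z = orbit (U ⊓ G : Subgroup H) y) := by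
  have hact' : IsSmoothAction E H F Z := hact.restrictScalars_real_prod
  constructor
  · intro X hXc hX x hx
    have hsub : closure (orbit G x) ⊆ X := by
      refine closure_minimal ?_ hXc.isClosed
      rintro _ ⟨a, rfl⟩
      exact hX a a.2 x hx
    have hinv : ∀ a ∈ G, ∀ w ∈ closure (orbit G x), a • w ∈ closure (orbit G x) := by
      intro a ha w hw
      refine map_mem_closure (hact'.mdifferentiable_smul a).continuous hw ?_
      rintro _ ⟨b, rfl⟩
      exact ⟨⟨a, ha⟩ * b, mul_smul a (b : H) x⟩
    obtain ⟨y, hy, hc, -⟩ := hμ.exists_orbit_eq hact' hB hU.isCompact hG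
      (hXc.of_isClosed_subset isClosed_closure hsub) ⟨x, subset_closure (mem_orbit_self x)⟩ hinv
    refine ⟨y, ?_, hc⟩
    rintro _ ⟨a, rfl⟩
    exact hinv a a.2 y hy
  · intro z hz
    -- The compact orbit is itself the invariant set, so the point `y` found in it has the same
    -- `G`-orbit.
    obtain ⟨y, hy, -, he⟩ := hμ.exists_orbit_eq hact' hB hU.isCompact hG hz
      ⟨z, mem_orbit_self z⟩ (by
        rintro a ha _ ⟨b, rfl⟩
        exact ⟨⟨a, ha⟩ * b, mul_smul a (b : H) z⟩)
    exact ⟨y, (orbit_eq_iff.2 hy).symm.trans he⟩
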